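/- All polynomials are over $\mathbb C$ in variables $x_0,x_1,\dots$. An IHL (input-homogeneous-linear) circuit over the arity-3 basis is a directed acyclic graph whose leaves are labelled with homogeneous linear forms and whose inner gates are additions of arity $2$ or multiplications of arity exactly $3$, each edge carrying a scalar from $\mathbb C$; its size is its number of gates and its depth the length of a longest path. IHL formulas over the arity-3 basis are the corresponding trees (forests, if there are several outputs), without scalars on the edges; the size is the number of vertices. Such a circuit or formula computes a homogeneous polynomial $f$ of even degree if every partial derivative $\partial f/\partial x_i$ with respect to a variable $x_i$ of $f$ is computed at some output; it computes any other polynomial $f$ if $f$ is computed at some output. **(1) Depth reduction.** For every polynomial $p$ there are a polynomial $q$ and a constant $C$ such that the following holds. Let $f$ be a polynomial of degree $d$ computed by an IHL circuit of size $s$ over the arity-3 basis, and suppose that every gate of the circuit computes a homogeneous polynomial, or that $d\le p(s)$. Then $f$ is computed by an IHL circuit over the arity-3 basis of size at most $q(s)$ and depth at most $C\cdot\log_2 s\cdot\log_2 d$ (with the convention $\log_2 0=0$). **(2) Collapse of classes.** A sequence $(f_n)$ is a p-family if the degree and the number of variables of $f_n$ are bounded by a polynomial in $n$. A sequence $(c_n)$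 of natural numbers is quasipolynomially bounded if there is a polynomial $q$ with $c_n\le n^{q(\log_2 n)}$ for all $n\ge2$. Let $\mathsf{VQF}$, $\mathsf{VQP}$, $\mathsf{VQBP}$ be the classes of p-families with quasipolynomially bounded algebraic formula size, algebraic circuit size (both with leaves labelled by variables or constants and with binary $+$ and $\times$), and algebraic branching program width, respectively. Here a polynomial of degree $d$ has an algebraic branching program of width $w$ if it is the product of a row vector, $d-2$ square matrices and a column vector, all of dimension $w$ and with affine linear forms as entries (for $d\le 1$: if $w\ge1$). Let $H$ be the set of sequences of homogeneous polynomials (of arbitrary degrees), and for a class $\mathsf C$ write $\mathsf C_H=\mathsf C\cap H$. Let $\mathsf{VQ3F}$ and $\mathsf{VQ3P}$ be the classes of p-families in $H$ with quasipolynomially bounded IHL formula size and IHL circuit size over the arity-3 basis, respectively. Then $\mathsf{VQ3F}=\mathsf{VQ3P}$, and moreover $$\mathsf{VQ3F}=\mathsf{VQF}_H=\mathsf{VQBP}_H=\mathsf{VQP}_H=\mathsf{VQ3P}.$$ -/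

import Mathlib

namespace AlgComplexity

/-- Polynomials over `ℂ` in the variables `x₀, x₁, x₂, …`. -/
abbrev Poly : Type := MvPolynomial ℕ ℂ

/-! ### Growth rates and p-families -/

/-- `c n ≤ q(n)` for a polynomial `q` and all `n`. -/
def PolyBounded (c : ℕ → ℕ) : Prop :=
  ∃ q : Polynomial ℕ, ∀ n, c n ≤ q.eval n

/-- `c n ≤ n ^ q(log₂ n)` for a polynomial `q` and all `n ≥ 2`. -/
def QuasiPolyBounded (c : ℕ → ℕ) : Prop :=
  ∃ q : Polynomial ℝ, ∀ n, 2 ≤ n → (c n : ℝ) ≤ (n : ℝ) ^ (q.eval (Real.logb 2 n))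

/-- A p-family: the number of variables and the degree are polynomially bounded. -/
def IsPFamily (f : ℕ → Poly) : Prop :=
  PolyBounded (fun n => (f n).vars.card) ∧ PolyBounded (fun n => (f n).totalDegree)

/-- The set `H` of sequences of homogeneous polynomials. -/
def H : Set (ℕ → Poly) :=
  {f | ∀ n, ∃ d, (f n).IsHomogeneous d}

/-- The p-families `f` for which the complexity of `f n` is quasipolynomially bounded; here
`HasComplexity s p` says that `p` is computed by some device of size at most `s`. -/
def quasiPolyClass (HasComplexity : ℕ → Poly → Prop) : Set (ℕ → Poly) :=
  {f | IsPFamily f ∧ ∃ c : ℕ → ℕ, QuasiPolyBounded c ∧ ∀ n, HasComplexity (c n) (f n)}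

/-! ### Formulas over the usual basis -/

/-- Algebraic formulas: trees whose leaves are variables or field constants. -/
inductive Formula : Type
  | var (i : ℕ) : Formula
  | const (a : ℂ) : Formula
  | add (F G : Formula) : Formula
  | mul (F G : Formula) : Formula

namespace Formula

/-- The polynomial computed at the root. -/
noncomputable def val : Formula → Poly
  | var i => MvPolynomial.X i
  | const a => MvPolynomial.C a
  | add F G => F.val + G.val
  | mul F G => F.val * G.val

/-- The number of vertices of the tree. -/
def size : Formula → ℕ
  | var _ => 1
  | const _ => 1
  | add F G => F.size + G.size + 1
  | mul F G => F.size + G.size + 1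

end Formula

/-! ### Circuits -/

/-- A directed acyclic graph with `s` gates, given in a topological order. The type `Gate k`
describes the gates whose inputs are taken among `k` earlier gates. -/
inductive Circuit (Gate : ℕ → Type) : ℕ → Type
  | nil : Circuit Gate 0
  | snoc {s : ℕ} (c : Circuit Gate s) (g : Gate s) : Circuit Gate (s + 1)

/-- Assign a value to every gate of a circuit, by recursion along the topological order. -/
def Circuit.fold {Gate : ℕ → Type} {α : Type} (step : (k : ℕ) → Gate k → (Fin k → α) → α) :
    {s : ℕ} → Circuit Gate s → Fin s → α
  | _, .nil => Fin.elim0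
  | _, .snoc (s := k) c g =>
      Fin.snoc (α := fun _ => α) (c.fold step) (step k g (c.fold step))

/-- Gates of ordinary algebraic circuits. -/
inductive Gate (k : ℕ) : Type
  | var (i : ℕ) : Gate k
  | const (a : ℂ) : Gate k
  | add (u v : Fin k) : Gate k
  | mul (u v : Fin k) : Gate k

/-- The polynomial computed at a gate, given those computed at the earlier gates. -/
noncomputable def Gate.eval (k : ℕ) (g : Gate k) (p : Fin k → Poly) : Poly :=
  match g with
  | .var i => MvPolynomial.X i
  | .const a => MvPolynomial.C a
  | .add u v => p u + p v
  | .mul u v => p u * p v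

/-! ### Input-homogeneous-linear (IHL) computation over the arity 3 basis -/

/-- Gates of IHL circuits over the arity 3 basis: leaves are labelled with homogeneous linear
forms, sums have arity 2, products have arity exactly 3. The edge entering a gate from its
input gate `u i` carries the scalar `a i`. -/
inductive IHLGate (k : ℕ) : Type
  | leaf (l : Poly) (hl : l.IsHomogeneous 1) : IHLGate k
  | add (a : Fin 2 → ℂ) (u : Fin 2 → Fin k) : IHLGate k
  | mul (a : Fin 3 → ℂ) (u : Fin 3 → Fin k) : IHLGate k

/-- The polynomial computed at a gate, given those computed at the earlier gates. -/
noncomputable def IHLGate.eval (k : ℕ) (g : IHLGate k) (p : Fin k → Poly) : Poly :=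
  match g with
  | .leaf l _ => l
  | .add a u => ∑ i, MvPolynomial.C (a i) * p (u i)
  | .mul a u => ∏ i, (MvPolynomial.C (a i) * p (u i))

/-- The depth of a gate (length of a longest path from a leaf), given those of the earlier
gates. -/
def IHLGate.height (k : ℕ) (g : IHLGate k) (h : Fin k → ℕ) : ℕ :=
  match g with
  | .leaf _ _ => 0
  | .add _ u => Finset.univ.sup (fun i => h (u i)) + 1
  | .mul _ u => Finset.univ.sup (fun i => h (u i)) + 1

/-- IHL circuits over the arity 3 basis with `s` gates. -/
abbrev IHLCircuit (s : ℕ) : Type := Circuit IHLGate s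

/-- The polynomial computed at each gate. -/
noncomputable def IHLCircuit.val {s : ℕ} (c : IHLCircuit s) : Fin s → Poly :=
  c.fold IHLGate.eval

/-- The length of a longest path in the circuit. -/
def IHLCircuit.depth {s : ℕ} (c : IHLCircuit s) : ℕ :=
  Finset.univ.sup (c.fold IHLGate.height)

/-- A circuit is homogeneous if every gate computes a homogeneous polynomial. -/
def IHLCircuit.IsHomogeneous {s : ℕ} (c : IHLCircuit s) : Prop :=
  ∀ u, ∃ d, (c.val u).IsHomogeneous d

/-- IHL formulas over the arity 3 basis (formulas carry no scalars on their edges). -/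
inductive IHLFormula : Type
  | leaf (l : Poly) (hl : l.IsHomogeneous 1) : IHLFormula
  | add (F G : IHLFormula) : IHLFormula
  | mul (F G K : IHLFormula) : IHLFormula

namespace IHLFormula

/-- The polynomial computed at the root. -/
noncomputable def val : IHLFormula → Poly
  | leaf l _ => l
  | add F G => F.val + G.val
  | mul F G K => F.val * G.val * K.val

/-- The number of vertices of the tree. -/
def size : IHLFormula → ℕ
  | leaf _ _ => 1
  | add F G => F.size + G.size + 1
  | mul F G K => F.size + G.size + K.size + 1

end IHLFormula

/-- What it means over the arity 3 basis to compute `f`, if `outs` is the set of polynomials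
computed at the individual gates. A homogeneous polynomial of even degree is computed through
all its partial derivatives, every other polynomial is computed directly. -/
def Computes3 (outs : Set Poly) (f : Poly) : Prop :=
  ((∃ d, Even d ∧ f.IsHomogeneous d) ∧ ∀ i ∈ f.vars, MvPolynomial.pderiv i f ∈ outs) ∨
  ((¬ ∃ d, Even d ∧ f.IsHomogeneous d) ∧ f ∈ outs)

/-- The circuit `c` over the arity 3 basis computes `f`. -/
def IHLCircuit.Computes {s : ℕ} (c : IHLCircuit s) (f : Poly) : Prop :=
  Computes3 (Set.range c.val) f

/-- A multi-output IHL formula over the arity 3 basis is a finite list of formulas, one for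
each output; it computes `f` in the following sense. -/
def IHLFormula.Computes (Fs : List IHLFormula) (f : Poly) : Prop :=
  Computes3 {p | ∃ F ∈ Fs, F.val = p} f

/-! ### Algebraic branching programs -/

/-- `f` has an algebraic branching program of width `w`: with `d = max (deg f) 1`, it is an entry
of a product of `d` matrices of size `w × w` whose entries are affine linear forms. (Only one row
of the first matrix and one column of the last matrix matter, so this is a product of a row
vector, `d - 2` matrices and a column vector if `d ≥ 2`, and an affine linear form if `d = 1`.) -/
def HasABP (w : ℕ) (f : Poly) : Prop :=
  ∃ (A : Fin (max f.totalDegree 1) → Matrix (Fin w) (Fin w) Poly) (i j : Fin w),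
    (∀ k a b, (A k a b).totalDegree ≤ 1) ∧ f = (List.ofFn A).prod i j

/-! ### The complexity classes -/

/-- Quasipolynomial formula complexity. -/
def VQF : Set (ℕ → Poly) :=
  quasiPolyClass fun s f => ∃ F : Formula, F.size ≤ s ∧ F.val = f

/-- Quasipolynomial branching program width. -/
def VQBP : Set (ℕ → Poly) :=
  quasiPolyClass fun s f => ∃ w, w ≤ s ∧ HasABP w f

/-- Quasipolynomial circuit complexity. -/
def VQP : Set (ℕ → Poly) :=
  quasiPolyClass fun s f =>
    ∃ t, t ≤ s ∧ ∃ c : Circuit Gate t, f ∈ Set.range (c.fold Gate.eval)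

/-- Homogeneous families of quasipolynomial IHL formula complexity over the arity 3 basis. -/
def VQ3F : Set (ℕ → Poly) :=
  H ∩ quasiPolyClass fun s f =>
    ∃ Fs : List IHLFormula, (Fs.map IHLFormula.size).sum ≤ s ∧ IHLFormula.Computes Fs f

/-- Homogeneous families of quasipolynomial IHL circuit complexity over the arity 3 basis. -/
def VQ3P : Set (ℕ → Poly) :=
  H ∩ quasiPolyClass fun s f => ∃ t, t ≤ s ∧ ∃ c : IHLCircuit t, c.Computes f

end AlgComplexity

/-! The core is a Valiant–Skyum–Berkowitz–Rackoff depth reduction adapted to products of three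
factors. Splitting a computation into homogeneous components gives a `Grammar`: a triangular system
in which each value of degree above 1 is a combination of values of equal degree and of triple
products with the heaviest factor first. If only that first factor is regarded as unknown, the
system is linear, y = b + E y, and the sums over chains `quot u v` are the entries of (1 - E)⁻¹.
Degrees never increase along an edge, so a chain passes a threshold m at one edge t → w, which must
come from a triple product. Hence val u is a sum of terms quot u t · val a · val w · val b with deg
w ≤ m < deg t, and `quot u v` has a similar expansion (`val_eq_crossing`, `quot_eq_crossing`). As w
is heaviest, a and b also have degree at most m. For m near the middle, the quotients have at most
half the degree of what is expanded.

IHL gates have only odd components, while quotients between odd degrees are even and not computable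
alone. The products `quotVal u v b` of a quotient with a value are odd, and they turn both
expansions into sums of products of exactly three available polynomials. Doubling the degree bound
then costs three balanced sums of depth logarithmic in the size (`Grammar.ihlComputable`), which
gives part (1) after about log d doublings.

For part (2), the same expansions give homogeneous branching programs of width N ^ O(log d)
(`Grammar.homogeneousABP`). For homogeneous f of degree d, an affine program may be replaced by its
linear parts, so f is an entry of a product of d linear matrices. A product of an odd number of
matrices splits recursively into three odd products, giving small IHL formulas; in even degree this
is applied to the derivatives, through Leibniz' rule. Conversely, ordinary devices simulate IHL ones
once the variables absent from f are set to zero, and Euler's identity recovers f from its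
derivatives. All losses are of the form X ^ O(log d + 1), which is quasipolynomial for p-families.
-/

open MvPolynomial
open scoped Pointwise

namespace AlgComplexity

/-! ### Homogeneous components and Euler's identity -/

section Components

/-- Homogeneous components of a product. -/
theorem homogeneousComponent_mul (n : ℕ) (p q : Poly) :
    homogeneousComponent n (p * q) =
      ∑ x ∈ Finset.HasAntidiagonal.antidiagonal n, homogeneousComponent x.1 p * homogeneousComponent x.2 q := by
  classical
  ext d
  rw [coeff_homogeneousComponent, coeff_sum]
  simp_rw [coeff_mul, coeff_homogeneousComponent]
  rw [Finset.sum_comm]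
  by_cases hd : d.degree = n
  · rw [if_pos hd]
    refine Finset.sum_congr rfl fun ab hab => ?_
    rw [Finset.HasAntidiagonal.mem_antidiagonal] at hab
    have hdeg : ab.1.degree + ab.2.degree = n := by
      rw [← hd, ← hab, map_add]
    rw [Finset.sum_eq_single (ab.1.degree, ab.2.degree)]
    · simp
    · rintro ⟨i, j⟩ - hne
      by_cases h1 : ab.1.degree = i
      · by_cases h2 : ab.2.degree = j
        · exact absurd (by simp [h1, h2]) hne
        · simp [h2]
      · simp [h1]
    · intro h
      exact absurd (Finset.HasAntidiagonal.mem_antidiagonal.2 hdeg) h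
  · rw [if_neg hd]
    symm
    refine Finset.sum_eq_zero fun ab hab => Finset.sum_eq_zero fun x hx => ?_
    rw [Finset.HasAntidiagonal.mem_antidiagonal] at hab hx
    by_cases h1 : ab.1.degree = x.1
    · by_cases h2 : ab.2.degree = x.2
      · exact absurd (by rw [← hab, map_add, h1, h2, hx]) hd
      · simp [h2]
    · simp [h1]

theorem homogeneousComponent_self {p : Poly} {n : ℕ} (h : p.IsHomogeneous n) :
    homogeneousComponent n p = p := by
  rw [homogeneousComponent_of_mem ((mem_homogeneousSubmodule _ _).2 h), if_pos rfl]

theorem homogeneousComponent_ne {p : Poly} {m n : ℕ} (h : p.IsHomogeneous n) (hm : m ≠ n) :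
    homogeneousComponent m p = 0 := by
  rw [homogeneousComponent_of_mem ((mem_homogeneousSubmodule _ _).2 h), if_neg hm]

theorem sum_homogeneousComponent_range {p : Poly} {d : ℕ} (h : p.totalDegree ≤ d) :
    ∑ i ∈ Finset.range (d + 1), homogeneousComponent i p = p := by
  conv_rhs => rw [← sum_homogeneousComponent p]
  symm
  refine Finset.sum_subset (Finset.range_subset_range.2 (by omega)) fun i _ hi => ?_
  exact homogeneousComponent_eq_zero _ _ (by simpa using hi)

/-- Euler's identity for polynomials in infinitely many variables. -/
theorem euler_identity {p : Poly} {n : ℕ} (h : p.IsHomogeneous n) :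
    ∑ i ∈ p.vars, X i * pderiv i p = (n : Poly) * p := by
  classical
  have key : ∀ V : Finset ℕ, p.vars ⊆ V → ∑ i ∈ V, X i * pderiv i p = (n : Poly) * p := by
    intro V hV
    have h2 : ∀ i, X i * pderiv i p = ∑ m ∈ p.support, (m i) • monomial m (coeff m p) := by
      intro i
      conv_lhs => rw [p.as_sum, map_sum, Finset.mul_sum]
      exact Finset.sum_congr rfl fun m _ => X_mul_pderiv_monomial
    simp_rw [h2]
    rw [Finset.sum_comm]
    conv_rhs => rw [p.as_sum, Finset.mul_sum]
    refine Finset.sum_congr rfl fun m hm => ?_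
    rw [← Finset.sum_smul]
    have h3 : ∑ i ∈ V, m i = n := by
      have h4 : m.degree = n := by
        by_contra hne
        exact (mem_support_iff.1 hm) (h.coeff_eq_zero hne)
      rw [← h4, Finsupp.degree_apply]
      symm
      refine Finset.sum_subset (fun i hi => hV ((mem_vars_iff_mem_support i).2 ⟨m, hm, hi⟩)) fun i _ hi => ?_
      simpa using hi
    rw [h3, nsmul_eq_mul]
  exact key _ subset_rfl

theorem isHomogeneous_pderiv {p : Poly} {n : ℕ} (h : p.IsHomogeneous (n + 1)) (i : ℕ) :
    (pderiv i p).IsHomogeneous n := h.pderiv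

theorem isHomogeneous_zero_of_totalDegree {p : Poly} (h : p.totalDegree = 0) :
    p.IsHomogeneous 0 := (totalDegree_zero_iff_isHomogeneous _).1 h

theorem vars_eq_empty_of_totalDegree {p : Poly} (h : p.totalDegree = 0) : p.vars = ∅ := by
  rw [totalDegree_eq_zero_iff_eq_C] at h
  rw [h, vars_C]

theorem eq_C_of_isHomogeneous_zero {p : Poly} (h : p.IsHomogeneous 0) : ∃ a, p = C a :=
  ⟨_, totalDegree_eq_zero_iff_eq_C.1 ((totalDegree_zero_iff_isHomogeneous _).2 h)⟩

end Components
end AlgComplexity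

namespace AlgComplexity

/-! ### Polynomial and quasipolynomial growth -/

section Growth

/-- A polynomial is bounded by a power of its argument, for arguments at least `2`. -/
theorem exists_eval_le_pow (p : Polynomial ℕ) : ∃ K, ∀ s, 2 ≤ s → p.eval s ≤ s ^ K := by
  induction p using Polynomial.induction_on' with
  | add p q hp hq =>
    obtain ⟨K, hK⟩ := hp
    obtain ⟨L, hL⟩ := hq
    refine ⟨max K L + 1, fun s hs => ?_⟩
    rw [Polynomial.eval_add, pow_succ]
    have h1 : s ^ K ≤ s ^ max K L := Nat.pow_le_pow_right (by omega) (le_max_left _ _)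
    have h2 : s ^ L ≤ s ^ max K L := Nat.pow_le_pow_right (by omega) (le_max_right _ _)
    have := hK s hs
    have := hL s hs
    nlinarith
  | monomial n a =>
    -- The coefficient is absorbed by a < 2 ^ a ≤ s ^ a, which needs s ≥ 2.
    refine ⟨a + n, fun s hs => ?_⟩
    rw [Polynomial.eval_monomial, pow_add]
    refine Nat.mul_le_mul_right _ ?_
    exact (Nat.lt_two_pow_self).le.trans (Nat.pow_le_pow_left hs a)

/-- Quasipolynomial growth, with integer logarithms. -/
def LogQuasiPoly (c : ℕ → ℕ) : Prop :=
  ∃ k, ∀ n, 2 ≤ n → c n ≤ 2 ^ (Nat.log 2 n + 2) ^ k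

theorem exists_real_eval_le_pow (q : Polynomial ℝ) :
    ∃ k : ℕ, ∀ x y : ℝ, 0 ≤ x → x ≤ y → 2 ≤ y → q.eval x ≤ y ^ k := by
  induction q using Polynomial.induction_on' with
  | add p q hp hq =>
    obtain ⟨K, hK⟩ := hp
    obtain ⟨L, hL⟩ := hq
    refine ⟨max K L + 1, fun x y hx hxy hy => ?_⟩
    rw [Polynomial.eval_add, pow_succ]
    have h1 : y ^ K ≤ y ^ max K L := pow_le_pow_right₀ (by linarith) (le_max_left _ _)
    have h2 : y ^ L ≤ y ^ max K L := pow_le_pow_right₀ (by linarith) (le_max_right _ _)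
    have := hK x y hx hxy hy
    have := hL x y hx hxy hy
    have : 0 ≤ y ^ max K L := by positivity
    nlinarith
  | monomial n a =>
    obtain ⟨b, hb⟩ := pow_unbounded_of_one_lt a (one_lt_two (α := ℝ))
    refine ⟨b + n, fun x y hx hxy hy => ?_⟩
    rw [Polynomial.eval_monomial, pow_add]
    have h1 : x ^ n ≤ y ^ n := pow_le_pow_left₀ hx hxy n
    have h2 : (2 : ℝ) ^ b ≤ y ^ b := pow_le_pow_left₀ (by norm_num) hy b
    exact mul_le_mul (hb.le.trans h2) h1 (by positivity) (by positivity)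

theorem logb_le_log_add_one (n : ℕ) : Real.logb 2 n ≤ Nat.log 2 n + 1 := by
  rcases Nat.eq_zero_or_pos n with rfl | hn
  · simp
  · rw [Real.logb_le_iff_le_rpow (by norm_num) (by exact_mod_cast hn)]
    have := (Nat.lt_pow_succ_log_self (b := 2) (by norm_num) n).le
    exact_mod_cast this

theorem log_le_logb {n : ℕ} (hn : 1 ≤ n) : (Nat.log 2 n : ℝ) ≤ Real.logb 2 n := by
  rw [Real.le_logb_iff_rpow_le (by norm_num) (by exact_mod_cast hn)]
  have := Nat.pow_log_le_self 2 (x := n) (by omega)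
  exact_mod_cast this

theorem one_le_logb {n : ℕ} (hn : 2 ≤ n) : 1 ≤ Real.logb 2 n := by
  rw [Real.le_logb_iff_rpow_le (by norm_num) (by exact_mod_cast (by omega : 0 < n))]
  exact_mod_cast (by simpa using hn)

/-- Writing n as 2 ^ log n costs one further power of the logarithm. The shift by 2 pays for
rounding and keeps the base at least 2, so that constants are absorbed by powers. -/
theorem quasiPolyBounded_iff (c : ℕ → ℕ) : QuasiPolyBounded c ↔ LogQuasiPoly c := by
  constructor
  · rintro ⟨q, hq⟩
    obtain ⟨k, hk⟩ := exists_real_eval_le_pow q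
    refine ⟨k + 1, fun n hn => ?_⟩
    have h1 := one_le_logb hn
    have h2 := logb_le_log_add_one n
    have h3 := hk (Real.logb 2 n) (Nat.log 2 n + 2) (by linarith) (by linarith) (by linarith)
    have hn0 : (0 : ℝ) < n := by exact_mod_cast (by omega : 0 < n)
    have h4 : (c n : ℝ) ≤ 2 ^ (Real.logb 2 n * q.eval (Real.logb 2 n)) := by
      rw [Real.rpow_mul (by norm_num), Real.rpow_logb (by norm_num) (by norm_num) hn0]
      exact hq n hn
    have h5 : Real.logb 2 n * q.eval (Real.logb 2 n) ≤
        (((Nat.log 2 n + 2) ^ (k + 1) : ℕ) : ℝ) := by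
      push_cast
      rw [pow_succ']
      have : (0 : ℝ) ≤ (Nat.log 2 n + 2 : ℝ) ^ k := by positivity
      calc _ ≤ Real.logb 2 n * (Nat.log 2 n + 2 : ℝ) ^ k := by gcongr
        _ ≤ _ := by gcongr; linarith
    have h6 := h4.trans (Real.rpow_le_rpow_of_exponent_le (by norm_num : (1 : ℝ) ≤ 2) h5)
    rw [Real.rpow_natCast] at h6
    exact_mod_cast h6
  · rintro ⟨k, hk⟩
    refine ⟨(Polynomial.X + 2) ^ k, fun n hn => ?_⟩
    have h1 := one_le_logb hn
    have hn0 : (0 : ℝ) < n := by exact_mod_cast (by omega : 0 < n)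
    have h2 : (c n : ℝ) ≤ (2 : ℝ) ^ (((Nat.log 2 n + 2) ^ k : ℕ) : ℝ) := by
      rw [Real.rpow_natCast]
      exact_mod_cast hk n hn
    refine h2.trans ?_
    have h3 : (n : ℝ) ^ (Polynomial.eval (Real.logb 2 n) ((Polynomial.X + 2) ^ k)) =
        2 ^ (Real.logb 2 n * (Real.logb 2 n + 2) ^ k) := by
      rw [Real.rpow_mul (by norm_num), Real.rpow_logb (by norm_num) (by norm_num) hn0]
      simp
    rw [h3]
    refine Real.rpow_le_rpow_of_exponent_le (by norm_num) ?_
    push_cast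
    have h4 := log_le_logb (n := n) (by omega)
    calc (Nat.log 2 n + 2 : ℝ) ^ k ≤ (Real.logb 2 n + 2) ^ k := by gcongr
      _ ≤ _ := le_mul_of_one_le_left (by positivity) h1

theorem LogQuasiPoly.mono {a b : ℕ → ℕ} (hb : LogQuasiPoly b) (h : ∀ n, 2 ≤ n → a n ≤ b n) :
    LogQuasiPoly a := by
  obtain ⟨k, hk⟩ := hb
  exact ⟨k, fun n hn => (h n hn).trans (hk n hn)⟩

theorem two_pow_pow_mul_le (l a b : ℕ) (hl : 2 ≤ l) :
    2 ^ l ^ a * 2 ^ l ^ b ≤ 2 ^ l ^ (max a b + 1) := by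
  rw [← pow_add]
  refine Nat.pow_le_pow_right (by norm_num) ?_
  have h1 : l ^ a ≤ l ^ max a b := Nat.pow_le_pow_right (by omega) (le_max_left _ _)
  have h2 : l ^ b ≤ l ^ max a b := Nat.pow_le_pow_right (by omega) (le_max_right _ _)
  rw [pow_succ]
  have := Nat.mul_le_mul_left (l ^ max a b) hl
  omega

theorem LogQuasiPoly.mul {a b : ℕ → ℕ} (ha : LogQuasiPoly a) (hb : LogQuasiPoly b) :
    LogQuasiPoly fun n => a n * b n := by
  obtain ⟨k, hk⟩ := ha
  obtain ⟨l, hl⟩ := hb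
  exact ⟨_, fun n hn => (Nat.mul_le_mul (hk n hn) (hl n hn)).trans
    (two_pow_pow_mul_le _ _ _ (by omega))⟩

theorem LogQuasiPoly.add_one {a : ℕ → ℕ} (ha : LogQuasiPoly a) :
    LogQuasiPoly fun n => a n + 1 := by
  obtain ⟨k, hk⟩ := ha
  refine ⟨k + 1, fun n hn => ?_⟩
  have := hk n hn
  have h1 : (Nat.log 2 n + 2) ^ k + 1 ≤ (Nat.log 2 n + 2) ^ (k + 1) := by
    rw [pow_succ]
    have := Nat.one_le_pow k (Nat.log 2 n + 2) (by omega)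
    nlinarith
  have h2 := Nat.pow_le_pow_right (n := 2) (by norm_num) h1
  rw [pow_succ] at h2
  have := Nat.one_le_pow ((Nat.log 2 n + 2) ^ k) 2 (by omega)
  show a n + 1 ≤ _
  omega

theorem LogQuasiPoly.add {a b : ℕ → ℕ} (ha : LogQuasiPoly a) (hb : LogQuasiPoly b) :
    LogQuasiPoly fun n => a n + b n :=
  (ha.add_one.mul hb.add_one).mono fun n _ => by nlinarith

theorem PolyBounded.logQuasiPoly {c : ℕ → ℕ} (h : PolyBounded c) : LogQuasiPoly c := by
  obtain ⟨q, hq⟩ := h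
  obtain ⟨K, hK⟩ := exists_eval_le_pow q
  refine ⟨K + 1, fun n hn => (hq n).trans ((hK n hn).trans ?_)⟩
  have h1 := (Nat.lt_pow_succ_log_self (b := 2) (by norm_num) n).le
  calc n ^ K ≤ (2 ^ (Nat.log 2 n + 1)) ^ K := Nat.pow_le_pow_left h1 K
    _ = 2 ^ ((Nat.log 2 n + 1) * K) := (pow_mul _ _ _).symm
    _ ≤ _ := by
      refine Nat.pow_le_pow_right (by norm_num) ?_
      rw [pow_succ']
      refine Nat.mul_le_mul (by omega) ?_
      exact Nat.lt_two_pow_self.le.trans (Nat.pow_le_pow_left (by omega) K)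

theorem LogQuasiPoly.const (K : ℕ) : LogQuasiPoly fun _ => K :=
  PolyBounded.logQuasiPoly ⟨Polynomial.C K, fun n => by simp⟩

/-- The exponent may grow like the logarithm of a quasipolynomial. -/
theorem LogQuasiPoly.pow_clog {a d : ℕ → ℕ} (ha : LogQuasiPoly a) (hd : LogQuasiPoly d) (K : ℕ) :
    LogQuasiPoly fun n => a n ^ (K * (Nat.clog 2 (d n) + 1)) := by
  obtain ⟨k, hk⟩ := ha
  obtain ⟨l, hl⟩ := hd
  -- With L = log₂ n + 2, the three factors of the exponent are at most L ^ k, K ≤ 2 ^ K ≤ L ^ K and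
  -- L ^ (l + 1).
  refine ⟨k + (K + (l + 1)), fun n hn => ?_⟩
  have h1 : Nat.clog 2 (d n) ≤ (Nat.log 2 n + 2) ^ l :=
    (Nat.clog_le_iff_le_pow (by norm_num)).2 (hl n hn)
  have h2 : Nat.clog 2 (d n) + 1 ≤ (Nat.log 2 n + 2) ^ (l + 1) := by
    rw [pow_succ]
    have := Nat.one_le_pow l (Nat.log 2 n + 2) (by omega)
    nlinarith
  have h3 : K ≤ (Nat.log 2 n + 2) ^ K :=
    Nat.lt_two_pow_self.le.trans (Nat.pow_le_pow_left (by omega) K)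
  calc _ ≤ (2 ^ (Nat.log 2 n + 2) ^ k) ^ (K * (Nat.clog 2 (d n) + 1)) :=
        Nat.pow_le_pow_left (hk n hn) _
    _ = 2 ^ ((Nat.log 2 n + 2) ^ k * (K * (Nat.clog 2 (d n) + 1))) := (pow_mul _ _ _).symm
    _ ≤ _ := by
      refine Nat.pow_le_pow_right (by norm_num) ?_
      rw [pow_add _ k, pow_add _ K]
      exact Nat.mul_le_mul_left _ (Nat.mul_le_mul h3 h2)

/-- Transfer of quasipolynomial bounds between complexity measures of homogeneous polynomials. -/
theorem quasiPolyClass_inter_H_subset {P Q : ℕ → Poly → Prop} (K : ℕ)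
    (h : ∀ s f d, f.IsHomogeneous d → P s f →
      ∃ t, t ≤ (s + f.vars.card + f.totalDegree + 2) ^ (K * (Nat.clog 2 f.totalDegree + 1)) ∧ Q t f)
    (hQ : ∀ s t f, s ≤ t → Q s f → Q t f) :
    quasiPolyClass P ∩ H ⊆ quasiPolyClass Q ∩ H := by
  rintro f ⟨⟨hf, c, hc, hP⟩, hH⟩
  refine ⟨⟨hf, fun n => (c n + (f n).vars.card + (f n).totalDegree + 2) ^
    (K * (Nat.clog 2 (f n).totalDegree + 1)), ?_, fun n => ?_⟩, hH⟩
  · rw [quasiPolyBounded_iff] at hc ⊢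
    exact (((hc.add hf.1.logQuasiPoly).add hf.2.logQuasiPoly).add
      (LogQuasiPoly.const 2)).pow_clog hf.2.logQuasiPoly K
  · obtain ⟨d, hd⟩ := hH n
    obtain ⟨t, ht, hq⟩ := h _ _ d hd (hP n)
    exact hQ _ _ _ ht hq

end Growth
end AlgComplexity

/-! ### Homogeneous systems, gate quotients and the crossing formulas -/

namespace AlgComplexity

/-- A system of equations satisfied by homogeneous polynomials `val u`: every `val u` is a linear
combination of polynomials of the same degree and of products of three polynomials, the first
factor of which has the largest degree. All dependencies strictly decrease the rank, and the
inhomogeneous part `base` is confined to degree at most `1`. -/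
structure Grammar (ι : Type) [Fintype ι] where
  rank : ι → ℕ
  deg : ι → ℕ
  val : ι → Poly
  base : ι → Poly
  lin : ι → ι → ℂ
  tri : ι → ι → ι → ι → ℂ
  homogeneous : ∀ u, (val u).IsHomogeneous (deg u)
  base_eq_zero : ∀ u, 1 < deg u → base u = 0
  lin_ne_zero : ∀ u w, lin u w ≠ 0 → rank w < rank u ∧ deg w = deg u
  tri_ne_zero : ∀ u w a b, tri u w a b ≠ 0 → rank w < rank u ∧
    deg w + deg a + deg b = deg u ∧ deg a ≤ deg w ∧ deg b ≤ deg w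
  val_eq : ∀ u, val u = base u + ∑ w, C (lin u w) * val w +
    ∑ w, ∑ a, ∑ b, C (tri u w a b) * (val w * val a * val b)

namespace Grammar

variable {ι : Type} [Fintype ι] (G : Grammar ι)

/-- The coefficient of `val w` in the equation for `val u`, the first factor of a product being
regarded as the unknown. -/
noncomputable def edge (u w : ι) : Poly :=
  C (G.lin u w) + ∑ a, ∑ b, C (G.tri u w a b) * (G.val a * G.val b)

theorem val_eq_edge (u : ι) : G.val u = G.base u + ∑ w, G.edge u w * G.val w := by
  conv_lhs => rw [G.val_eq u]
  rw [add_assoc, ← Finset.sum_add_distrib]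
  congr 1
  refine Finset.sum_congr rfl fun w _ => ?_
  rw [edge, add_mul, Finset.sum_mul]
  congr 1
  refine Finset.sum_congr rfl fun a _ => ?_
  rw [Finset.sum_mul]
  exact Finset.sum_congr rfl fun b _ => by ring

theorem edge_eq_zero {u w : ι} (h : ¬ (G.rank w < G.rank u ∧ G.deg w ≤ G.deg u)) :
    G.edge u w = 0 := by
  have h1 : G.lin u w = 0 := by
    by_contra h1
    have := G.lin_ne_zero u w h1
    exact h ⟨this.1, this.2.le⟩
  have h2 : ∀ a b, G.tri u w a b = 0 := by
    intro a b
    by_contra h2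
    have := G.tri_ne_zero u w a b h2
    exact h ⟨this.1, by omega⟩
  simp [edge, h1, h2]

theorem edge_homogeneous (u w : ι) : (G.edge u w).IsHomogeneous (G.deg u - G.deg w) := by
  refine IsHomogeneous.add ?_ ?_
  · by_cases h : G.lin u w = 0
    · rw [h, C_0]
      exact isHomogeneous_zero _ _ _
    · rw [(G.lin_ne_zero u w h).2, Nat.sub_self]
      exact isHomogeneous_C _ _
  · refine IsHomogeneous.sum _ _ _ fun a _ => IsHomogeneous.sum _ _ _ fun b _ => ?_
    by_cases h : G.tri u w a b = 0
    · rw [h, C_0, zero_mul]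
      exact isHomogeneous_zero _ _ _
    · have h1 := (G.tri_ne_zero u w a b h).2.1
      have h2 : G.deg u - G.deg w = G.deg a + G.deg b := by omega
      rw [h2]
      exact ((G.homogeneous a).mul (G.homogeneous b)).C_mul _

theorem edge_eq_of_deg_lt {u w : ι} (h : G.deg w < G.deg u) :
    G.edge u w = ∑ a, ∑ b, C (G.tri u w a b) * (G.val a * G.val b) := by
  have h1 : G.lin u w = 0 := by
    by_contra h1
    have := G.lin_ne_zero u w h1
    omega
  rw [edge, h1, C_0, zero_add]

open Classical in
/-- The sum of the weights of all chains of edges from `u` to `v`. -/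
noncomputable def quot (u v : ι) : Poly :=
  (if u = v then 1 else 0) +
    ∑ w, if _h : G.rank w < G.rank u then G.edge u w * quot w v else 0
termination_by G.rank u

-- The rank guard in the definition serves termination only, since edges that do not lower the rank
-- vanish. What remains is the matrix identity Q = 1 + E Q.
open Classical in
theorem quot_eq (u v : ι) :
    G.quot u v = (if u = v then 1 else 0) + ∑ w, G.edge u w * G.quot w v := by
  rw [quot]
  congr 1
  refine Finset.sum_congr rfl fun w _ => ?_
  split_ifs with h
  · rfl
  · rw [G.edge_eq_zero (fun h' => h h'.1), zero_mul]

theorem rank_induction {P : ι → Prop} (h : ∀ u, (∀ w, G.rank w < G.rank u → P w) → P u) (u : ι) :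
    P u := by
  induction hn : G.rank u using Nat.strong_induction_on generalizing u with
  | _ n ih => exact h u fun w hw => ih _ (hn ▸ hw) w rfl

/-- Degrees never increase along a chain. -/
theorem quot_eq_zero (v u : ι) : G.deg u < G.deg v → G.quot u v = 0 := by
  induction u using G.rank_induction with
  | _ u ih =>
    intro h
    rw [quot_eq, if_neg (by rintro rfl; omega), zero_add]
    refine Finset.sum_eq_zero fun w _ => ?_
    by_cases hw : G.rank w < G.rank u ∧ G.deg w ≤ G.deg u
    · rw [ih w hw.1 (by omega), mul_zero]
    · rw [G.edge_eq_zero hw, zero_mul]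

theorem quot_homogeneous (v u : ι) : (G.quot u v).IsHomogeneous (G.deg u - G.deg v) := by
  induction u using G.rank_induction with
  | _ u ih =>
    rw [quot_eq]
    refine IsHomogeneous.add ?_ (IsHomogeneous.sum _ _ _ fun w _ => ?_)
    · split_ifs with h
      · rw [h, Nat.sub_self]
        exact isHomogeneous_one _ _
      · exact isHomogeneous_zero _ _ _
    · by_cases hw : G.rank w < G.rank u ∧ G.deg w ≤ G.deg u
      · by_cases hv : G.deg w < G.deg v
        · rw [G.quot_eq_zero _ _ hv, mul_zero]
          exact isHomogeneous_zero _ _ _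
        · have : G.deg u - G.deg v = (G.deg u - G.deg w) + (G.deg w - G.deg v) := by omega
          rw [this]
          exact (G.edge_homogeneous u w).mul (ih w hw.1)
      · rw [G.edge_eq_zero hw, zero_mul]
        exact isHomogeneous_zero _ _ _

/-- Cutting all chains at the edge where the degree drops to at most `m`. -/
theorem cut {m : ℕ} {y : ι → Poly} (hy : ∀ u, m < G.deg u → y u = ∑ w, G.edge u w * y w) (u : ι) :
    m < G.deg u → y u = ∑ t with m < G.deg t, G.quot u t *
      ∑ w with ¬ m < G.deg w, G.edge t w * y w := by
  classical
  induction u using G.rank_induction with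
  | _ u ih =>
    intro hu
    set z : ι → Poly := fun t => ∑ w with ¬ m < G.deg w, G.edge t w * y w with hz
    have h1 : ∀ w ∈ Finset.univ.filter (fun w => m < G.deg w), G.edge u w * y w =
        ∑ t with m < G.deg t, G.edge u w * G.quot w t * z t := by
      intro w hw
      by_cases hr : G.rank w < G.rank u ∧ G.deg w ≤ G.deg u
      · rw [ih w hr.1 (by simpa using hw), Finset.mul_sum]
        exact Finset.sum_congr rfl fun t _ => by ring
      · simp [G.edge_eq_zero hr]
    -- This is `quot_eq` with the light w dropped, for which `quot w t` vanishes by degree. The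
    -- correction at t = u later cancels against the light part of the equation for u.
    have h2 : ∀ t ∈ Finset.univ.filter (fun t => m < G.deg t),
        ∑ w with m < G.deg w, G.edge u w * G.quot w t =
          G.quot u t - if u = t then 1 else 0 := by
      intro t ht
      rw [eq_sub_iff_add_eq, add_comm, G.quot_eq u t]
      congr 1
      refine Finset.sum_subset (Finset.subset_univ _) fun w _ hw => ?_
      have hw' : G.deg w < G.deg t := by
        simp only [Finset.mem_filter, Finset.mem_univ, true_and] at hw ht
        omega
      rw [G.quot_eq_zero _ _ hw', mul_zero]
    rw [hy u hu, ← Finset.sum_filter_add_sum_filter_not _ (fun w => m < G.deg w),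
      Finset.sum_congr rfl h1, Finset.sum_comm]
    simp_rw [← Finset.sum_mul]
    rw [Finset.sum_congr rfl fun t ht => by rw [h2 t ht]]
    simp_rw [sub_mul, Finset.sum_sub_distrib]
    rw [Finset.sum_eq_single_of_mem u (by simpa using hu) (f := fun t =>
      (if u = t then 1 else 0) * z t) (fun t _ ht => by rw [if_neg (Ne.symm ht), zero_mul])]
    simp [hz]

/-- The coefficients of the products at which chains cross the degree `m`. -/
noncomputable def crossing (m : ℕ) (x : ι × ι × ι × ι) : ℂ :=
  if G.deg x.2.1 ≤ m ∧ m < G.deg x.1 then G.tri x.1 x.2.1 x.2.2.1 x.2.2.2 else 0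

theorem crossing_ne_zero {m : ℕ} {t w a b : ι} (h : G.crossing m (t, w, a, b) ≠ 0) :
    G.deg w ≤ m ∧ m < G.deg t ∧ G.deg w + G.deg a + G.deg b = G.deg t ∧
      G.deg a ≤ G.deg w ∧ G.deg b ≤ G.deg w := by
  unfold crossing at h
  dsimp only at h
  split_ifs at h with h1
  · exact ⟨h1.1, h1.2, (G.tri_ne_zero _ _ _ _ h).2⟩
  · exact absurd rfl h

/-- Linear edges preserve the degree, so the edge crossing the threshold comes from triple products
alone. -/
theorem cut_crossing {m : ℕ} {y : ι → Poly}
    (hy : ∀ u, m < G.deg u → y u = ∑ w, G.edge u w * y w) (u : ι) (hu : m < G.deg u) :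
    y u = ∑ x : ι × ι × ι × ι, C (G.crossing m x) *
      (G.quot u x.1 * G.val x.2.2.1 * (y x.2.1 * G.val x.2.2.2)) := by
  rw [G.cut hy u hu, Fintype.sum_prod_type, Finset.sum_filter]
  refine Finset.sum_congr rfl fun t _ => ?_
  rw [Fintype.sum_prod_type]
  split_ifs with ht
  · rw [Finset.sum_filter, Finset.mul_sum]
    refine Finset.sum_congr rfl fun w _ => ?_
    rw [Fintype.sum_prod_type]
    split_ifs with hw
    swap
    · rw [G.edge_eq_of_deg_lt (by omega), Finset.sum_mul, Finset.mul_sum]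
      refine Finset.sum_congr rfl fun a _ => ?_
      rw [Finset.sum_mul, Finset.mul_sum]
      refine Finset.sum_congr rfl fun b _ => ?_
      rw [crossing, if_pos ⟨by simpa using hw, ht⟩]
      ring
    · rw [mul_zero]
      symm
      refine Finset.sum_eq_zero fun a _ => Finset.sum_eq_zero fun b _ => ?_
      rw [crossing, if_neg (by dsimp only; omega), C_0, zero_mul]
  · symm
    refine Finset.sum_eq_zero fun w _ => ?_
    rw [Fintype.sum_prod_type]
    refine Finset.sum_eq_zero fun a _ => Finset.sum_eq_zero fun b _ => ?_
    rw [crossing, if_neg (by dsimp only; omega), C_0, zero_mul]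

/-- Above a threshold of at least 1 the inhomogeneous part vanishes, so the values solve the system
required by `cut_crossing`. -/
theorem val_eq_crossing {m : ℕ} (hm : 1 ≤ m) (u : ι) (hu : m < G.deg u) :
    G.val u = ∑ x : ι × ι × ι × ι, C (G.crossing m x) *
      (G.quot u x.1 * G.val x.2.2.1 * (G.val x.2.1 * G.val x.2.2.2)) := by
  refine G.cut_crossing (y := G.val) (fun u hu => ?_) u hu
  conv_lhs => rw [G.val_eq_edge u]
  rw [G.base_eq_zero u (by omega), zero_add]

/-- For fixed v the quotients solve the homogeneous system except at v itself, which lies below the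
cut. -/
theorem quot_eq_crossing {m : ℕ} (u v : ι) (hv : G.deg v ≤ m) (hu : m < G.deg u) :
    G.quot u v = ∑ x : ι × ι × ι × ι, C (G.crossing m x) *
      (G.quot u x.1 * G.val x.2.2.1 * (G.quot x.2.1 v * G.val x.2.2.2)) := by
  refine G.cut_crossing (y := fun u => G.quot u v) (fun u hu => ?_) u hu
  conv_lhs => rw [G.quot_eq u v]
  rw [if_neg (by rintro rfl; omega), zero_add]

end Grammar
end AlgComplexity

/-! ### Homogenizing straight-line computations -/

namespace AlgComplexity

/-- The first `s` terms of `x` are computed one after the other, starting from affine linear forms,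
by linear combinations of two and products of three earlier terms. -/
def IsStraightLine (s : ℕ) (x : ℕ → Poly) : Prop :=
  ∀ u < s, (x u).totalDegree ≤ 1 ∨
    (∃ a b v w, v < u ∧ w < u ∧ x u = C a * x v + C b * x w) ∨
    (∃ a v w z, v < u ∧ w < u ∧ z < u ∧ x u = C a * (x v * x w * x z))

section Homogenization

variable {ι : Type} (rank deg : ι → ℕ) (val : ι → Poly)

open Classical in
/-- The polynomials which may be combined linearly in the equation for `val u`. -/
noncomputable def admissible (u : ι) : ι ⊕ (ι × ι × ι) → Poly
  | .inl w => if rank w < rank u ∧ deg w = deg u then val w else 0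
  | .inr (w, a, b) => if rank w < rank u ∧ deg w + deg a + deg b = deg u ∧
      deg a ≤ deg w ∧ deg b ≤ deg w then val w * val a * val b else 0

theorem mem_span_admissible {u w : ι} (h1 : rank w < rank u) (h2 : deg w = deg u) :
    val w ∈ Submodule.span ℂ (Set.range (admissible rank deg val u)) :=
  Submodule.subset_span ⟨.inl w, if_pos ⟨h1, h2⟩⟩

/-- Commutativity allows the heaviest of the three factors to be moved to the front. -/
theorem mul_mem_span_admissible {u p q r : ι} (hp : rank p < rank u) (hq : rank q < rank u)
    (hr : rank r < rank u) (h : deg p + deg q + deg r = deg u) :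
    val p * val q * val r ∈ Submodule.span ℂ (Set.range (admissible rank deg val u)) := by
  have key : ∀ w a b : ι, rank w < rank u → deg w + deg a + deg b = deg u → deg a ≤ deg w →
      deg b ≤ deg w → val w * val a * val b ∈
        Submodule.span ℂ (Set.range (admissible rank deg val u)) := fun w a b h1 h2 h3 h4 =>
    Submodule.subset_span ⟨.inr (w, a, b), if_pos ⟨h1, h2, h3, h4⟩⟩
  by_cases h1 : deg q ≤ deg p ∧ deg r ≤ deg p
  · exact key p q r hp h h1.1 h1.2
  · by_cases h2 : deg p ≤ deg q ∧ deg r ≤ deg q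
    · rw [mul_comm (val p)]
      exact key q p r hq (by omega) h2.1 h2.2
    · rw [mul_comm _ (val r), ← mul_assoc]
      exact key r p q hr (by omega) (by omega) (by omega)

theorem exists_grammar_of_mem_span [Fintype ι] (hom : ∀ u, (val u).IsHomogeneous (deg u))
    (h : ∀ u, 1 < deg u →
      val u ∈ Submodule.span ℂ (Set.range (admissible rank deg val u))) :
    ∃ G : Grammar ι, G.rank = rank ∧ G.deg = deg ∧ G.val = val := by
  classical
  have h' : ∀ u, ∃ c : ι ⊕ (ι × ι × ι) → ℂ, 1 < deg u →
      ∑ j, c j • admissible rank deg val u j = val u := by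
    intro u
    by_cases hu : 1 < deg u
    · obtain ⟨c, hc⟩ := (Submodule.mem_span_range_iff_exists_fun ℂ).1 (h u hu)
      exact ⟨c, fun _ => hc⟩
    · exact ⟨0, fun h => absurd h hu⟩
  choose c hc using h'
  refine ⟨{
    rank := rank
    deg := deg
    val := val
    base := fun u => if 1 < deg u then 0 else val u
    lin := fun u w => if 1 < deg u ∧ rank w < rank u ∧ deg w = deg u then c u (.inl w) else 0
    tri := fun u w a b => if 1 < deg u ∧ rank w < rank u ∧ deg w + deg a + deg b = deg u ∧
      deg a ≤ deg w ∧ deg b ≤ deg w then c u (.inr (w, a, b)) else 0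
    homogeneous := hom
    base_eq_zero := fun u hu => if_pos hu
    lin_ne_zero := ?_
    tri_ne_zero := ?_
    val_eq := ?_ }, rfl, rfl, rfl⟩
  · intro u w hne
    split_ifs at hne with h1
    · exact h1.2
    · exact absurd rfl hne
  · intro u w a b hne
    split_ifs at hne with h1
    · exact h1.2
    · exact absurd rfl hne
  · intro u
    by_cases hu : 1 < deg u
    · conv_lhs => rw [← hc u hu]
      rw [if_pos hu, zero_add, Fintype.sum_sum_type]
      simp_rw [Fintype.sum_prod_type]
      congr 1
      · refine Finset.sum_congr rfl fun w _ => ?_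
        simp only [admissible, hu, true_and]
        split_ifs
        · rw [smul_eq_C_mul]
        · simp
      · refine Finset.sum_congr rfl fun w _ => Finset.sum_congr rfl fun a _ =>
          Finset.sum_congr rfl fun b _ => ?_
        simp only [admissible, hu, true_and]
        split_ifs
        · rw [smul_eq_C_mul]
        · simp
    · simp [hu]

/-- Splitting a straight-line computation into homogeneous components. -/
theorem IsStraightLine.exists_grammar {s : ℕ} {x : ℕ → Poly} (hx : IsStraightLine s x) {d : ℕ}
    {D : Finset ℕ} (hd : ∀ i ∈ D, i ≤ d)
    (hD : ∀ u < s, ∀ i ≤ d, i ∉ D → homogeneousComponent i (x u) = 0) :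
    ∃ G : Grammar (Fin s × D), (∀ p, G.deg p = p.2) ∧
      ∀ p, G.val p = homogeneousComponent p.2 (x p.1) := by
  obtain ⟨G, -, h1, h2⟩ := exists_grammar_of_mem_span (ι := Fin s × D)
    (fun p => p.1) (fun p => p.2) (fun p => homogeneousComponent p.2 (x p.1))
    (fun p => homogeneousComponent_isHomogeneous _ _) (fun ⟨⟨u, hu⟩, ⟨k, hk⟩⟩ hk1 => by
      set S := Submodule.span ℂ (Set.range (admissible (ι := Fin s × D) (fun p => p.1)
        (fun p => p.2) (fun p => homogeneousComponent p.2 (x p.1)) (⟨u, hu⟩, ⟨k, hk⟩))) with hS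
      dsimp only at hk1 ⊢
      have hlin : ∀ v < u, homogeneousComponent k (x v) ∈ S := fun v hv =>
        mem_span_admissible (ι := Fin s × D) (fun p => p.1)
          (fun p => p.2) (fun p => homogeneousComponent p.2 (x p.1))
          (u := (⟨u, hu⟩, ⟨k, hk⟩)) (w := (⟨v, hv.trans hu⟩, ⟨k, hk⟩)) hv rfl
      rcases hx u hu with h | ⟨a, b, v, w, hv, hw, h⟩ | ⟨a, v, w, z, hv, hw, hz, h⟩
      · rw [homogeneousComponent_eq_zero _ _ (by omega)]
        exact S.zero_mem
      · rw [h, map_add, homogeneousComponent_C_mul, homogeneousComponent_C_mul,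
          ← smul_eq_C_mul, ← smul_eq_C_mul]
        exact S.add_mem (S.smul_mem _ (hlin v hv)) (S.smul_mem _ (hlin w hw))
      · rw [h, homogeneousComponent_C_mul, ← smul_eq_C_mul, homogeneousComponent_mul]
        refine S.smul_mem _ (S.sum_mem fun y hy => ?_)
        rw [homogeneousComponent_mul, Finset.sum_mul]
        refine S.sum_mem fun y' hy' => ?_
        rw [Finset.HasAntidiagonal.mem_antidiagonal] at hy hy'
        have hkd := hd k hk
        by_cases h1 : y'.1 ∈ D
        swap
        · rw [hD v (by omega) _ (by omega) h1, zero_mul, zero_mul]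
          exact S.zero_mem
        by_cases h2 : y'.2 ∈ D
        swap
        · rw [hD w (by omega) _ (by omega) h2, mul_zero, zero_mul]
          exact S.zero_mem
        by_cases h3 : y.2 ∈ D
        swap
        · rw [hD z (by omega) _ (by omega) h3, mul_zero]
          exact S.zero_mem
        exact mul_mem_span_admissible (ι := Fin s × D) (fun p => p.1)
          (fun p => p.2) (fun p => homogeneousComponent p.2 (x p.1))
          (u := (⟨u, hu⟩, ⟨k, hk⟩)) (p := (⟨v, hv.trans hu⟩, ⟨_, h1⟩))
          (q := (⟨w, hw.trans hu⟩, ⟨_, h2⟩)) (r := (⟨z, hz.trans hu⟩, ⟨_, h3⟩))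
          hv hw hz (by dsimp only; omega))
  exact ⟨G, fun p => by rw [h1], fun p => by rw [h2]⟩

end Homogenization
end AlgComplexity

/-! ### Circuits as sequences of polynomials -/

namespace AlgComplexity

section Circuits

variable {Gate : ℕ → Type} {α : Type}

theorem Circuit.fold_castSucc (step : (k : ℕ) → Gate k → (Fin k → α) → α) {s : ℕ}
    (c : Circuit Gate s) (g : Gate s) (u : Fin s) :
    (c.snoc g).fold step u.castSucc = c.fold step u := by
  rw [Circuit.fold, Fin.snoc_castSucc]

theorem Circuit.fold_last (step : (k : ℕ) → Gate k → (Fin k → α) → α) {s : ℕ}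
    (c : Circuit Gate s) (g : Gate s) :
    (c.snoc g).fold step (Fin.last s) = step s g (c.fold step) := by
  rw [Circuit.fold, Fin.snoc_last]

/-- The gate is found before the interpretation is chosen, so one statement serves both values and
heights. -/
theorem Circuit.exists_gate {s : ℕ} (c : Circuit Gate s) (u : Fin s) : ∃ g : Gate u,
    ∀ (α : Type) (step : (k : ℕ) → Gate k → (Fin k → α) → α),
      c.fold step u = step u g fun j => c.fold step (j.castLE u.2.le) := by
  induction c with
  | nil => exact u.elim0
  | snoc c g ih =>
    induction u using Fin.lastCases with
    | last =>
      refine ⟨g, fun α step => ?_⟩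
      rw [Circuit.fold_last]
      congr 1
      funext j
      exact (Circuit.fold_castSucc step c g j).symm
    | cast u =>
      obtain ⟨g', hg'⟩ := ih u
      refine ⟨g', fun α step => ?_⟩
      rw [Circuit.fold_castSucc, hg']
      congr 1
      funext j
      exact (Circuit.fold_castSucc step c g _).symm

/-- The values at the gates of a circuit as a sequence. -/
noncomputable def Circuit.seq (step : (k : ℕ) → Gate k → (Fin k → Poly) → Poly) {s : ℕ}
    (c : Circuit Gate s) (n : ℕ) : Poly :=
  if h : n < s then c.fold step ⟨n, h⟩ else 0

theorem Circuit.seq_eq (step : (k : ℕ) → Gate k → (Fin k → Poly) → Poly) {s : ℕ}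
    (c : Circuit Gate s) (u : Fin s) : c.seq step u = c.fold step u :=
  dif_pos u.2

theorem Circuit.exists_gate_seq (step : (k : ℕ) → Gate k → (Fin k → Poly) → Poly) {s : ℕ}
    (c : Circuit Gate s) {u : ℕ} (hu : u < s) : ∃ g : Gate u,
    c.seq step u = step u g fun j => c.seq step j := by
  obtain ⟨g, hg⟩ := c.exists_gate ⟨u, hu⟩
  refine ⟨g, ?_⟩
  rw [show c.seq step u = _ from c.seq_eq step ⟨u, hu⟩, hg]
  congr 1
  funext j
  exact (c.seq_eq step _).symm

end Circuits

/-- The first `s` terms of `x` are computed by the gates of an IHL circuit over the arity 3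
basis. -/
def IsIHLLine (s : ℕ) (x : ℕ → Poly) : Prop :=
  ∀ u < s, (x u).IsHomogeneous 1 ∨
    (∃ a b v w, v < u ∧ w < u ∧ x u = C a * x v + C b * x w) ∨
    (∃ a v w z, v < u ∧ w < u ∧ z < u ∧ x u = C a * (x v * x w * x z))

theorem IHLCircuit.isIHLLine {s : ℕ} (c : IHLCircuit s) : IsIHLLine s (c.seq IHLGate.eval) := by
  intro u hu
  obtain ⟨g, hg⟩ := c.exists_gate_seq IHLGate.eval hu
  rw [hg]
  cases g with
  | leaf l hl => exact .inl hl
  | add a v =>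
    refine .inr (.inl ⟨a 0, a 1, v 0, v 1, (v 0).2, (v 1).2, ?_⟩)
    simp [IHLGate.eval]
  | mul a v =>
    refine .inr (.inr ⟨a 0 * a 1 * a 2, v 0, v 1, v 2, (v 0).2, (v 1).2, (v 2).2, ?_⟩)
    simp only [IHLGate.eval, Fin.prod_univ_three, C_mul]
    ring

namespace IsIHLLine

variable {s : ℕ} {x : ℕ → Poly}

theorem isStraightLine (h : IsIHLLine s x) : IsStraightLine s x := fun u hu =>
  (h u hu).imp_left fun h => h.totalDegree_le

/-- Linear forms are odd, and oddness survives sums and triple products: three degrees with an even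
sum include an even one. Hence polynomials of even degree are accessible only through derivatives.
-/
theorem homogeneousComponent_even (h : IsIHLLine s x) (u : ℕ) (hu : u < s) :
    ∀ i, Even i → homogeneousComponent i (x u) = 0 := by
  induction u using Nat.strong_induction_on with
  | _ u ih =>
    intro i hi
    rcases h u hu with h | ⟨a, b, v, w, hv, hw, h⟩ | ⟨a, v, w, z, hv, hw, hz, h⟩
    · exact homogeneousComponent_ne h (by rintro rfl; exact absurd hi (by decide))
    · rw [h, map_add, homogeneousComponent_C_mul, homogeneousComponent_C_mul,
        ih v hv (by omega) i hi, ih w hw (by omega) i hi]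
      simp
    · rw [h, homogeneousComponent_C_mul, homogeneousComponent_mul, Finset.sum_eq_zero, mul_zero]
      intro y hy
      rw [homogeneousComponent_mul, Finset.sum_mul]
      refine Finset.sum_eq_zero fun y' hy' => ?_
      rw [Finset.HasAntidiagonal.mem_antidiagonal] at hy hy'
      by_cases h1 : Even y'.1
      · rw [ih v hv (by omega) _ h1, zero_mul, zero_mul]
      by_cases h2 : Even y'.2
      · rw [ih w hw (by omega) _ h2, mul_zero, zero_mul]
      have h3 : Even y.2 := by
        rw [← hy, ← hy'] at hi
        have := (Nat.not_even_iff_odd.1 h1).add_odd (Nat.not_even_iff_odd.1 h2)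
        exact (Nat.even_add.1 hi).1 this
      rw [ih z hz (by omega) _ h3, mul_zero]

theorem totalDegree_le (h : IsIHLLine s x) (u : ℕ) (hu : u < s) : (x u).totalDegree ≤ 3 ^ u := by
  induction u using Nat.strong_induction_on with
  | _ u ih =>
    have hC : ∀ (a : ℂ) (p : Poly), (C a * p).totalDegree ≤ p.totalDegree := fun a p => by
      rw [← smul_eq_C_mul]
      exact totalDegree_smul_le a p
    have ih' : ∀ v < u, 3 * (x v).totalDegree ≤ 3 ^ u := fun v hv => by
      have h1 := ih v hv (by omega)
      have h2 : 3 ^ (v + 1) ≤ 3 ^ u := Nat.pow_le_pow_right (by norm_num) hv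
      rw [pow_succ] at h2
      omega
    rcases h u hu with h | ⟨a, b, v, w, hv, hw, h⟩ | ⟨a, v, w, z, hv, hw, hz, h⟩
    · exact h.totalDegree_le.trans (Nat.one_le_pow _ _ (by norm_num))
    · rw [h]
      refine (totalDegree_add _ _).trans (max_le ?_ ?_)
      · have := hC a (x v)
        have := ih' v hv
        omega
      · have := hC b (x w)
        have := ih' w hw
        omega
    · rw [h]
      have h1 := hC a (x v * x w * x z)
      have h2 := totalDegree_mul (x v * x w) (x z)
      have h3 := totalDegree_mul (x v) (x w)
      have := ih' v hv
      have := ih' w hw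
      have := ih' z hz
      omega

end IsIHLLine

/-! ### Building IHL circuits layer by layer -/

section Building

/-- The polynomials in `S` are computed by an IHL circuit of size at most `n` and depth at
most `h`. -/
def IHLComputable (n h : ℕ) (S : Set Poly) : Prop :=
  ∃ t, t ≤ n ∧ ∃ c : IHLCircuit t, c.depth ≤ h ∧ S ⊆ Set.range c.val

theorem IHLComputable.mono {n n' h h' : ℕ} {S S' : Set Poly} (hc : IHLComputable n h S)
    (hn : n ≤ n') (hh : h ≤ h') (hS : S' ⊆ S) : IHLComputable n' h' S' := by
  obtain ⟨t, ht, c, h1, h2⟩ := hc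
  exact ⟨t, ht.trans hn, c, h1.trans hh, hS.trans h2⟩

/-- The polynomials computed by a gate whose inputs compute elements of `S`. -/
inductive OneStep (S : Set Poly) : Poly → Prop
  | leaf (l : Poly) (hl : l.IsHomogeneous 1) : OneStep S l
  | add (a b : ℂ) (f g : Poly) (hf : f ∈ S) (hg : g ∈ S) : OneStep S (C a * f + C b * g)
  | mul (a : ℂ) (f g h : Poly) (hf : f ∈ S) (hg : g ∈ S) (hh : h ∈ S) :
      OneStep S (C a * (f * g * h))

/-- Zero is homogeneous of degree 1 and so a legal leaf, which allows sums to be padded to exactly 2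
^ k terms. -/
theorem OneStep.zero (S : Set Poly) : OneStep S 0 := .leaf 0 (isHomogeneous_zero _ _ _)

theorem OneStep.smul {S : Set Poly} (a : ℂ) {f : Poly} (hf : f ∈ S) : OneStep S (C a * f) := by
  have := OneStep.add (S := S) a 0 f f hf hf
  rwa [C_0, zero_mul, add_zero] at this

theorem OneStep.of_mem {S : Set Poly} {f : Poly} (hf : f ∈ S) : OneStep S f := by
  have := OneStep.smul 1 hf
  rwa [C_1, one_mul] at this

theorem OneStep.exists_gate {S : Set Poly} {t h : ℕ} (c : IHLCircuit t)
    (hS : ∀ f ∈ S, ∃ u, c.val u = f ∧ c.fold IHLGate.height u ≤ h) {f : Poly} (hf : OneStep S f) :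
    ∃ g : IHLGate t, g.eval t c.val = f ∧ g.height t (c.fold IHLGate.height) ≤ h + 1 := by
  cases hf with
  | leaf _ hl => exact ⟨.leaf f hl, rfl, Nat.zero_le _⟩
  | add a b f g hf hg =>
    obtain ⟨u, rfl, hu⟩ := hS _ hf
    obtain ⟨v, rfl, hv⟩ := hS _ hg
    refine ⟨.add ![a, b] ![u, v], by simp [IHLGate.eval], ?_⟩
    simp only [IHLGate.height, Nat.add_le_add_iff_right, Finset.sup_le_iff]
    intro i _
    fin_cases i <;> assumption
  | mul a f g k hf hg hk =>
    obtain ⟨u, rfl, hu⟩ := hS _ hf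
    obtain ⟨v, rfl, hv⟩ := hS _ hg
    obtain ⟨w, rfl, hw⟩ := hS _ hk
    refine ⟨.mul ![a, 1, 1] ![u, v, w], ?_, ?_⟩
    · simp [IHLGate.eval, Fin.prod_univ_three, mul_assoc]
    · simp only [IHLGate.height, Nat.add_le_add_iff_right, Finset.sup_le_iff]
      intro i _
      fin_cases i <;> assumption

theorem IHLCircuit.depth_le_iff {s : ℕ} (c : IHLCircuit s) (h : ℕ) :
    c.depth ≤ h ↔ ∀ u, c.fold IHLGate.height u ≤ h := by
  simp [IHLCircuit.depth, Finset.sup_le_iff]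

/-- Adding one layer of gates to a circuit. -/
theorem IHLComputable.step {n h : ℕ} {S : Set Poly} (hS : IHLComputable n h S) (T : Finset Poly)
    (hT : ∀ f ∈ T, OneStep S f) : IHLComputable (n + T.card) (h + 1) (S ∪ T) := by
  classical
  obtain ⟨t, ht, c, hc, hcS⟩ := hS
  rw [c.depth_le_iff] at hc
  -- The invariant keeps gates of height at most h for S, so the new gates read from these and never
  -- stack on each other.
  have key : ∃ c' : IHLCircuit (t + T.card), c'.depth ≤ h + 1 ∧
      (∀ f ∈ S, ∃ u, c'.val u = f ∧ c'.fold IHLGate.height u ≤ h) ∧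
      ∀ f ∈ T, f ∈ Set.range c'.val := by
    induction T using Finset.induction_on with
    | empty =>
      refine ⟨c, (c.depth_le_iff _).2 fun u => (hc u).trans (Nat.le_succ h), fun f hf => ?_,
        fun f hf => absurd hf (Finset.notMem_empty f)⟩
      obtain ⟨u, rfl⟩ := hcS hf
      exact ⟨u, rfl, hc u⟩
    | insert f T hfT ih =>
      obtain ⟨c', h1, h2, h3⟩ := ih fun f hf => hT f (Finset.mem_insert_of_mem hf)
      rw [c'.depth_le_iff] at h1
      obtain ⟨g, hg1, hg2⟩ := (hT f (Finset.mem_insert_self _ _)).exists_gate c' h2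
      rw [Finset.card_insert_of_notMem hfT]
      have hval : ∀ u, IHLCircuit.val (c'.snoc g) (Fin.castSucc u) = c'.val u := fun u =>
        Circuit.fold_castSucc _ _ _ u
      refine ⟨c'.snoc g, (IHLCircuit.depth_le_iff _ _).2 fun u => ?_, fun f' hf' => ?_,
        fun f' hf' => ?_⟩
      · induction u using Fin.lastCases with
        | last => exact (Circuit.fold_last IHLGate.height c' g).le.trans hg2
        | cast u => rw [Circuit.fold_castSucc]; exact h1 u
      · obtain ⟨u, hu1, hu2⟩ := h2 f' hf'
        exact ⟨u.castSucc, by rw [hval, hu1], by rw [Circuit.fold_castSucc]; exact hu2⟩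
      · rcases Finset.mem_insert.1 hf' with rfl | hf'
        · exact ⟨Fin.last _, (Circuit.fold_last IHLGate.eval c' g).trans hg1⟩
        · obtain ⟨u, hu⟩ := h3 f' hf'
          exact ⟨u.castSucc, by rw [hval, hu]⟩
  obtain ⟨c', h1, h2, h3⟩ := key
  refine ⟨_, Nat.add_le_add_right ht _, c', h1, ?_⟩
  rintro f (hf | hf)
  · obtain ⟨u, hu, -⟩ := h2 f hf
    exact ⟨u, hu⟩
  · exact h3 f hf

theorem IHLComputable.leaves (T : Finset Poly) (hT : ∀ f ∈ T, f.IsHomogeneous 1) :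
    IHLComputable T.card 0 T := by
  classical
  induction T using Finset.induction_on with
  | empty => exact ⟨0, le_rfl, .nil, by simp [IHLCircuit.depth], by simp⟩
  | insert f T hfT ih =>
    obtain ⟨t, ht, c, h1, h2⟩ := ih fun f hf => hT f (Finset.mem_insert_of_mem hf)
    rw [c.depth_le_iff] at h1
    rw [Finset.card_insert_of_notMem hfT]
    refine ⟨t + 1, Nat.succ_le_succ ht, c.snoc (.leaf f (hT f (Finset.mem_insert_self _ _))),
      (IHLCircuit.depth_le_iff _ _).2 fun u => ?_, fun f' hf' => ?_⟩
    · induction u using Fin.lastCases with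
      | last => rw [Circuit.fold_last]; exact le_rfl
      | cast u => rw [Circuit.fold_castSucc]; exact h1 u
    · rcases Finset.mem_insert.1 (Finset.mem_coe.1 hf') with rfl | hf'
      · exact ⟨Fin.last _, by rw [IHLCircuit.val, Circuit.fold_last]; rfl⟩
      · obtain ⟨u, hu⟩ := h2 hf'
        exact ⟨u.castSucc, by rw [IHLCircuit.val, Circuit.fold_castSucc]; exact hu⟩

/-- Sums of `2 ^ k` polynomials with the property `P`. -/
def IsSumOf (P : Poly → Prop) : ℕ → Poly → Prop
  | 0, f => P f
  | k + 1, f => ∃ g h, IsSumOf P k g ∧ IsSumOf P k h ∧ f = g + h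

theorem IsSumOf.zero {P : Poly → Prop} (h0 : P 0) : ∀ k, IsSumOf P k 0
  | 0 => h0
  | k + 1 => ⟨0, 0, .zero h0 k, .zero h0 k, (add_zero 0).symm⟩

theorem IsSumOf.sum {P : Poly → Prop} (h0 : P 0) {κ : Type} (t : κ → Poly) :
    ∀ (k : ℕ) (I : Finset κ), I.card ≤ 2 ^ k → (∀ i ∈ I, P (t i)) →
      IsSumOf P k (∑ i ∈ I, t i) := by
  classical
  intro k
  induction k with
  | zero =>
    intro I hI ht
    rcases Nat.le_one_iff_eq_zero_or_eq_one.1 (by simpa using hI) with h | h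
    · rw [Finset.card_eq_zero.1 h, Finset.sum_empty]
      exact h0
    · obtain ⟨i, rfl⟩ := Finset.card_eq_one.1 h
      rw [Finset.sum_singleton]
      exact ht i (Finset.mem_singleton_self i)
  | succ k ih =>
    intro I hI ht
    obtain ⟨J, hJ, hJc⟩ := Finset.exists_subset_card_eq (s := I) (n := min I.card (2 ^ k))
      (min_le_left _ _)
    refine ⟨∑ i ∈ J, t i, ∑ i ∈ I \ J, t i, ih J (by omega) fun i hi => ht i (hJ hi),
      ih _ ?_ fun i hi => ht i (Finset.mem_sdiff.1 hi).1, ?_⟩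
    · rw [Finset.card_sdiff_of_subset hJ, hJc]
      rw [pow_succ] at hI
      omega
    · rw [add_comm, Finset.sum_sdiff hJ]

/-- Adding sums of `2 ^ k` polynomials computed in one further layer. -/
theorem IHLComputable.sums {S : Set Poly} (k : ℕ) :
    ∀ {n h : ℕ}, IHLComputable n h S → ∀ T : Finset Poly, (∀ f ∈ T, IsSumOf (OneStep S) k f) →
      IHLComputable (n + T.card * (2 ^ (k + 1) - 1)) (h + k + 1) (S ∪ T) := by
  classical
  induction k with
  | zero =>
    intro n h hS T hT
    exact (hS.step T hT).mono (by simp) le_rfl subset_rfl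
  | succ k ih =>
    intro n h hS T hT
    have hT' : ∀ f : T, ∃ g h, IsSumOf (OneStep S) k g ∧ IsSumOf (OneStep S) k h ∧ f.1 = g + h :=
      fun f => hT f.1 f.2
    choose g g' hg hg' hsum using hT'
    set T' : Finset Poly := Finset.univ.image g ∪ Finset.univ.image g' with hT'_def
    have hcard : T'.card ≤ 2 * T.card := by
      refine (Finset.card_union_le _ _).trans ?_
      have h1 := Finset.card_image_le (s := (Finset.univ : Finset T)) (f := g)
      have h2 := Finset.card_image_le (s := (Finset.univ : Finset T)) (f := g')
      rw [Finset.card_univ, Fintype.card_coe] at h1 h2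
      omega
    have h1 := ih hS T' (by
      intro f hf
      rcases Finset.mem_union.1 hf with hf | hf
      · obtain ⟨a, -, rfl⟩ := Finset.mem_image.1 hf
        exact hg a
      · obtain ⟨a, -, rfl⟩ := Finset.mem_image.1 hf
        exact hg' a)
    have h2 := h1.step T fun f hf => by
      have e : f = C 1 * g ⟨f, hf⟩ + C 1 * g' ⟨f, hf⟩ := by
        rw [C_1, one_mul, one_mul]
        exact hsum ⟨f, hf⟩
      rw [e]
      refine .add _ _ _ _ (.inr ?_) (.inr ?_)
      · exact Finset.mem_coe.2 (Finset.mem_union_left _ (Finset.mem_image_of_mem _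
          (Finset.mem_univ _)))
      · exact Finset.mem_coe.2 (Finset.mem_union_right _ (Finset.mem_image_of_mem _
          (Finset.mem_univ _)))
    refine h2.mono ?_ (by omega) (Set.union_subset_union_left _ Set.subset_union_left)
    have h3 : 1 ≤ 2 ^ (k + 1) := Nat.one_le_two_pow
    have h4 : 2 ^ (k + 1 + 1) - 1 = 2 * (2 ^ (k + 1) - 1) + 1 := by
      rw [pow_succ 2 (k + 1)]
      omega
    rw [h4, mul_add, mul_one, ← mul_assoc, mul_comm T.card 2]
    have := Nat.mul_le_mul_right (2 ^ (k + 1) - 1) hcard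
    omega

end Building
end AlgComplexity

/-! ### Shallow circuits for grammars -/

namespace AlgComplexity

theorem IsSumOf.single {P : Poly → Prop} (h0 : P 0) (k : ℕ) {f : Poly} (hf : P f) :
    IsSumOf P k f := by
  have := IsSumOf.sum h0 (fun _ : Unit => f) k {()} (by simpa using Nat.one_le_two_pow)
    (fun _ _ => hf)
  simpa using this

namespace Grammar

variable {ι : Type} [Fintype ι] (G : Grammar ι)

/-- The product of a quotient with a value. -/
noncomputable def quotVal (u v b : ι) : Poly := G.quot u v * G.val b

/-- Crossing midway between deg v and deg u gives terms (quot u t · val a) · (quot w v · val b') ·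
val b. Both new quotients have at most half the degree, and a and b' have degree at most deg u - deg
v. -/
theorem isSumOf_quotVal {l : ℕ} (hl : Fintype.card ι ^ 4 ≤ 2 ^ l) {S : Set Poly} {u v b : ι}
    (hb : G.val b ∈ S)
    (hA : ∀ u' v' b', 2 * G.deg u' + G.deg v ≤ 2 * G.deg v' + G.deg u →
      G.deg b' + G.deg v ≤ G.deg u → G.quotVal u' v' b' ∈ S) :
    IsSumOf (OneStep S) l (G.quotVal u v b) := by
  rcases lt_trichotomy (G.deg u) (G.deg v) with h | h | h
  · rw [quotVal, G.quot_eq_zero _ _ h, zero_mul]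
    exact .zero (.zero S) l
  · have h1 := G.quot_homogeneous v u
    rw [h, Nat.sub_self] at h1
    obtain ⟨a, ha⟩ := eq_C_of_isHomogeneous_zero h1
    rw [quotVal, ha]
    exact .single (.zero S) l (.smul a hb)
  · rw [quotVal, G.quot_eq_crossing (m := G.deg v + (G.deg u - G.deg v) / 2) u v (by omega)
      (by omega), Finset.sum_mul]
    refine .sum (.zero S) _ l _ (by simpa [pow_succ, mul_assoc] using hl) ?_
    rintro ⟨t, w, a, b'⟩ -
    dsimp only
    by_cases h0 : G.crossing (G.deg v + (G.deg u - G.deg v) / 2) (t, w, a, b') = 0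
    · rw [h0, C_0, zero_mul, zero_mul]
      exact .zero S
    obtain ⟨h1, h2, h3, h4, h5⟩ := G.crossing_ne_zero h0
    by_cases hw : G.deg w < G.deg v
    · rw [G.quot_eq_zero _ _ hw, zero_mul, mul_zero, mul_zero, zero_mul]
      exact .zero S
    by_cases ht : G.deg u < G.deg t
    · rw [G.quot_eq_zero _ _ ht, zero_mul, zero_mul, mul_zero, zero_mul]
      exact .zero S
    rw [mul_assoc]
    exact .mul _ _ _ _ (hA u t a (by omega) (by omega)) (hA w v b' (by omega) (by omega)) hb

/-- Crossing at half the degree gives terms (quot u t · val a) · val w · val b, where all three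
values have at most half the degree. -/
theorem isSumOf_val {l : ℕ} (hl : Fintype.card ι ^ 4 ≤ 2 ^ l) {S : Set Poly} {u : ι}
    (hu : 2 ≤ G.deg u) (hV : ∀ w, 2 * G.deg w ≤ G.deg u → G.val w ∈ S)
    (hA : ∀ t b, G.deg u < 2 * G.deg t → 2 * G.deg b ≤ G.deg u → G.quotVal u t b ∈ S) :
    IsSumOf (OneStep S) l (G.val u) := by
  rw [G.val_eq_crossing (m := G.deg u / 2) (by omega) u (by omega)]
  refine .sum (.zero S) _ l _ (by simpa [pow_succ, mul_assoc] using hl) ?_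
  rintro ⟨t, w, a, b⟩ -
  dsimp only
  by_cases h0 : G.crossing (G.deg u / 2) (t, w, a, b) = 0
  · rw [h0, C_0, zero_mul]
    exact .zero S
  obtain ⟨h1, h2, h3, h4, h5⟩ := G.crossing_ne_zero h0
  rw [← mul_assoc (G.quot u t * G.val a)]
  exact .mul _ _ _ _ (hA t a (by omega) (by omega)) (hV w (by omega)) (hV b (by omega))

open Classical in
/-- The values of degree at most `r`. -/
noncomputable def valSet (r : ℕ) : Finset Poly :=
  (Finset.univ.filter fun u => G.deg u ≤ r).image G.val

open Classical in
/-- The products of quotients of degree less than `j / 2` with values of degree at most `r`. -/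
noncomputable def quotSet (j r : ℕ) : Finset Poly :=
  ((Finset.univ : Finset (ι × ι × ι)).filter fun x =>
    2 * G.deg x.1 < 2 * G.deg x.2.1 + j ∧ G.deg x.2.2 ≤ r).image fun x =>
      G.quotVal x.1 x.2.1 x.2.2

theorem card_valSet_le (r : ℕ) : (G.valSet r).card ≤ Fintype.card ι ^ 3 := by
  refine Finset.card_image_le.trans ((Finset.card_filter_le _ _).trans ?_)
  exact Nat.le_self_pow (by norm_num) _

theorem card_quotSet_le (j r : ℕ) : (G.quotSet j r).card ≤ Fintype.card ι ^ 3 := by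
  refine Finset.card_image_le.trans ((Finset.card_filter_le _ _).trans ?_)
  simp [Finset.card_univ, pow_succ, mul_assoc]

theorem mem_valSet {r : ℕ} {u : ι} (h : G.deg u ≤ r) : G.val u ∈ G.valSet r :=
  Finset.mem_image_of_mem _ (by simpa using h)

theorem mem_quotSet {j r : ℕ} {u v b : ι} (h : 2 * G.deg u < 2 * G.deg v + j) (hb : G.deg b ≤ r) :
    G.quotVal u v b ∈ G.quotSet j r :=
  Finset.mem_image.2 ⟨(u, v, b), by simpa using ⟨h, hb⟩, rfl⟩

theorem forall_valSet {r : ℕ} {P : Poly → Prop} (h : ∀ u, G.deg u ≤ r → P (G.val u)) :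
    ∀ f ∈ G.valSet r, P f := by
  intro f hf
  obtain ⟨u, hu, rfl⟩ := Finset.mem_image.1 hf
  exact h u (by simpa using hu)

theorem forall_quotSet {j r : ℕ} {P : Poly → Prop}
    (h : ∀ u v b, 2 * G.deg u < 2 * G.deg v + j → G.deg b ≤ r → P (G.quotVal u v b)) :
    ∀ f ∈ G.quotSet j r, P f := by
  intro f hf
  obtain ⟨⟨u, v, b⟩, hu, rfl⟩ := Finset.mem_image.1 hf
  simp only [Finset.mem_filter, Finset.mem_univ, true_and] at hu
  exact h u v b hu.1 hu.2

/-- Shallow circuits for the values of a grammar. -/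
theorem ihlComputable (hpos : ∀ u, 0 < G.deg u) {l : ℕ} (hl : Fintype.card ι ^ 4 ≤ 2 ^ l)
    (k : ℕ) : IHLComputable (2 * Fintype.card ι ^ 3 + k * (3 * Fintype.card ι ^ 3 * 2 ^ (l + 1)))
      (k * (3 * (l + 1))) (G.valSet (2 ^ k) ∪ G.quotSet (2 ^ k) (2 ^ k)) := by
  classical
  induction k with
  | zero =>
    -- At degree bound 1 the quotients involved are constants, so everything is a linear form and a
    -- leaf.
    have hval : ∀ u, G.deg u ≤ 1 → (G.val u).IsHomogeneous 1 := fun u hu => by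
      have h1 := G.homogeneous u
      have h2 := hpos u
      rwa [show G.deg u = 1 by omega] at h1
    have := IHLComputable.leaves (G.valSet (2 ^ 0) ∪ G.quotSet (2 ^ 0) (2 ^ 0)) (by
      intro f hf
      rcases Finset.mem_union.1 hf with hf | hf
      · exact G.forall_valSet (P := fun f => f.IsHomogeneous 1) hval f hf
      · refine G.forall_quotSet (P := fun f => f.IsHomogeneous 1) (fun u v b huv hb => ?_) f hf
        have h1 := (G.quot_homogeneous v u).mul (hval b hb)
        rwa [show G.deg u - G.deg v + 1 = 1 by omega] at h1)
    refine this.mono ?_ (by simp) (by simp)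
    refine (Finset.card_union_le _ _).trans ?_
    have := G.card_valSet_le (2 ^ 0)
    have := G.card_quotSet_le (2 ^ 0) (2 ^ 0)
    omega
  | succ k ih =>
    have hk : 2 ^ (k + 1) = 2 * 2 ^ k := by rw [pow_succ, mul_comm]
    -- Three rounds double the bound: larger quotients times old values, then the new values, which
    -- need just these products, then the larger quotients times new values. Each round costs `l +
    -- 1` layers.
    have h1 := ih.sums l (G.quotSet (2 ^ (k + 1)) (2 ^ k)) (G.forall_quotSet fun u v b huv hb =>
      G.isSumOf_quotVal hl (.inl (G.mem_valSet hb)) fun u' v' b' h h' =>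
        .inr (G.mem_quotSet (by omega) (by omega)))
    have h2 := h1.sums l (G.valSet (2 ^ (k + 1))) (G.forall_valSet fun u hu => by
      rcases Nat.lt_or_ge (G.deg u) 2 with h | h
      · refine .single (.zero _) l (.leaf _ ?_)
        have h1 := G.homogeneous u
        have h2 := hpos u
        rwa [show G.deg u = 1 by omega] at h1
      · exact G.isSumOf_val hl h (fun w hw => .inl (.inl (G.mem_valSet (by omega))))
          fun t b ht hb => .inr (G.mem_quotSet (by omega) (by omega)))
    have h3 := h2.sums l (G.quotSet (2 ^ (k + 1)) (2 ^ (k + 1)))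
      (G.forall_quotSet fun u v b huv hb =>
        G.isSumOf_quotVal hl (.inr (G.mem_valSet hb)) fun u' v' b' h h' =>
          .inl (.inl (.inr (G.mem_quotSet (by omega) (by omega)))))
    refine h3.mono ?_ (by ring_nf; omega) ?_
    · have e1 := Nat.mul_le_mul_right (2 ^ (l + 1) - 1) (G.card_quotSet_le (2 ^ (k + 1)) (2 ^ k))
      have e2 := Nat.mul_le_mul_right (2 ^ (l + 1) - 1) (G.card_valSet_le (2 ^ (k + 1)))
      have e3 := Nat.mul_le_mul_right (2 ^ (l + 1) - 1)
        (G.card_quotSet_le (2 ^ (k + 1)) (2 ^ (k + 1)))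
      have e4 := Nat.mul_le_mul_left (Fintype.card ι ^ 3) (Nat.sub_le (2 ^ (l + 1)) 1)
      rw [add_mul k 1, one_mul, mul_assoc 3]
      omega
    · rintro f (hf | hf)
      · exact .inl (.inr hf)
      · exact .inr hf

end Grammar
end AlgComplexity

/-! ### The depth reduction theorem -/

namespace AlgComplexity

theorem clog_le_logb_add_one {n : ℕ} (hn : 1 ≤ n) : (Nat.clog 2 n : ℝ) ≤ Real.logb 2 n + 1 := by
  rw [← Real.natCeil_logb_natCast]
  push_cast
  exact (Nat.ceil_lt_add_one (Real.logb_nonneg (by norm_num) (by exact_mod_cast hn))).le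

theorem logb_natCast_nonneg (n : ℕ) : 0 ≤ Real.logb 2 n := by
  rcases Nat.eq_zero_or_pos n with rfl | hn
  · simp
  · exact Real.logb_nonneg (by norm_num) (by exact_mod_cast hn)

theorem two_pow_clog_le {n : ℕ} (hn : 1 ≤ n) : 2 ^ Nat.clog 2 n ≤ 2 * n := by
  rcases Nat.lt_or_ge 1 n with h | h
  · have h1 := Nat.pow_pred_clog_lt_self (b := 2) (by norm_num) h
    have h2 : 0 < Nat.clog 2 n := Nat.clog_pos (by norm_num) (by omega)
    rw [← Nat.succ_pred_eq_of_pos h2, pow_succ]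
    omega
  · interval_cases n
    simp

open Classical in
/-- The degrees, up to `d`, of the homogeneous components occurring in a computation. -/
noncomputable def occurringDegrees (s d : ℕ) (x : ℕ → Poly) : Finset ℕ :=
  (Finset.range (d + 1)).filter fun i => ∃ u < s, homogeneousComponent i (x u) ≠ 0

/-- The grammar is indexed by gates and occurring degrees only; these degrees are odd, hence
positive. A last balanced sum reassembles each gate from its components. -/
theorem IHLCircuit.ihlComputable {s : ℕ} (c : IHLCircuit s) {d l k : ℕ}
    (hl : (s * (occurringDegrees s d (c.seq IHLGate.eval)).card) ^ 4 ≤ 2 ^ l)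
    (hl' : (occurringDegrees s d (c.seq IHLGate.eval)).card ≤ 2 ^ l) (hk : d ≤ 2 ^ k) :
    IHLComputable (2 * (s * (occurringDegrees s d (c.seq IHLGate.eval)).card) ^ 3 +
      k * (3 * (s * (occurringDegrees s d (c.seq IHLGate.eval)).card) ^ 3 * 2 ^ (l + 1)) +
      s * 2 ^ (l + 1)) (k * (3 * (l + 1)) + l + 1)
      {f | f ∈ Set.range c.val ∧ f.totalDegree ≤ d} := by
  classical
  set x := c.seq IHLGate.eval with hx
  set D := occurringDegrees s d x with hD
  have hDd : ∀ i ∈ D, i ≤ d := fun i hi => by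
    have := (Finset.mem_filter.1 hi).1
    simpa [Nat.lt_succ_iff] using this
  have hDc : ∀ u < s, ∀ i ≤ d, i ∉ D → homogeneousComponent i (x u) = 0 := by
    intro u hu i hi hiD
    by_contra hne
    exact hiD (Finset.mem_filter.2 ⟨by simpa [Nat.lt_succ_iff] using hi, u, hu, hne⟩)
  obtain ⟨G, hG1, hG2⟩ := c.isIHLLine.isStraightLine.exists_grammar hDd hDc
  have hcard : Fintype.card (Fin s × D) = s * D.card := by simp
  have hpos : ∀ p, 0 < G.deg p := by
    rintro ⟨u, i, hi⟩
    rw [hG1]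
    obtain ⟨v, hv, hne⟩ := (Finset.mem_filter.1 hi).2
    refine Nat.pos_of_ne_zero fun h => hne ?_
    exact c.isIHLLine.homogeneousComponent_even v hv i (by dsimp only at h; rw [h]; exact Even.zero)
  have h1 := G.ihlComputable hpos (l := l) (by rw [hcard]; exact hl) k
  rw [hcard] at h1
  set T : Finset Poly := (Finset.univ.image c.val).filter fun f => f.totalDegree ≤ d with hT
  have hTc : T.card ≤ s := (Finset.card_filter_le _ _).trans
    (Finset.card_image_le.trans (by simp))
  have h2 := h1.sums l T (by
    intro f hf
    obtain ⟨hf1, hf2⟩ := Finset.mem_filter.1 hf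
    obtain ⟨u, -, rfl⟩ := Finset.mem_image.1 hf1
    have e : c.val u = ∑ i ∈ D.attach, G.val (u, i) := by
      have e1 : ∀ i : D, G.val (u, i) = homogeneousComponent i (c.val u) := fun i => by
        rw [hG2, Circuit.seq_eq]
        rfl
      simp_rw [e1]
      rw [Finset.sum_attach D fun i => homogeneousComponent i (c.val u)]
      conv_lhs => rw [← sum_homogeneousComponent_range hf2]
      symm
      refine Finset.sum_subset (Finset.filter_subset _ _) fun i hi hiD => ?_
      have := hDc u u.2 i (by simpa [Nat.lt_succ_iff] using hi) hiD
      rwa [hx, Circuit.seq_eq] at this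
    rw [e]
    refine .sum (.zero _) _ l _ (by simpa using hl') fun i _ => .of_mem (.inl (G.mem_valSet ?_))
    rw [hG1]
    exact (hDd _ i.2).trans hk)
  refine h2.mono ?_ (by omega) ?_
  · have := Nat.mul_le_mul hTc (Nat.sub_le (2 ^ (l + 1)) 1)
    omega
  · rintro f ⟨⟨u, rfl⟩, hf⟩
    exact .inr (Finset.mem_coe.2 (Finset.mem_filter.2
      ⟨Finset.mem_image_of_mem _ (Finset.mem_univ _), hf⟩))

/-- By parity such gates are linear forms. This covers d ≤ 1, where log d = 0 forces depth 0. -/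
theorem IHLCircuit.ihlComputable_of_le_two {s : ℕ} (c : IHLCircuit s) {d : ℕ} (hd : d ≤ 2) :
    IHLComputable s 0 {f | f ∈ Set.range c.val ∧ f.totalDegree ≤ d} := by
  classical
  have h := IHLComputable.leaves ((Finset.univ.image c.val).filter fun f => f.totalDegree ≤ d) (by
    intro f hf
    obtain ⟨hf1, hf2⟩ := Finset.mem_filter.1 hf
    obtain ⟨u, -, rfl⟩ := Finset.mem_image.1 hf1
    have h1 := sum_homogeneousComponent_range (hf2.trans hd)
    have h2 := c.isIHLLine.homogeneousComponent_even u u.2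
    rw [Circuit.seq_eq] at h2
    rw [Finset.sum_range_succ, Finset.sum_range_succ, Finset.sum_range_one] at h1
    rw [← h1]
    have e0 : homogeneousComponent 0 (c.val u) = 0 := h2 0 (by decide)
    have e2 : homogeneousComponent 2 (c.val u) = 0 := h2 2 (by decide)
    rw [e0, e2, zero_add, add_zero]
    exact homogeneousComponent_isHomogeneous _ _)
  refine h.mono ?_ le_rfl ?_
  · exact (Finset.card_filter_le _ _).trans (Finset.card_image_le.trans (by simp))
  · rintro f ⟨⟨u, rfl⟩, hf⟩
    exact Finset.mem_coe.2 (Finset.mem_filter.2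
      ⟨Finset.mem_image_of_mem _ (Finset.mem_univ _), hf⟩)

/-- A first gate has no inputs to read, so it is a leaf; for s ≤ 1 the bound log s = 0 leaves no
room. -/
theorem IHLCircuit.depth_of_le_one {s : ℕ} (c : IHLCircuit s) (hs : s ≤ 1) : c.depth = 0 := by
  rw [← Nat.le_zero, c.depth_le_iff]
  intro u
  obtain ⟨g, hg⟩ := c.exists_gate u
  rw [hg]
  have hu : (u : ℕ) = 0 := by omega
  cases g with
  | leaf l hl => exact le_rfl
  | add a v => exact absurd (v 0).2 (by omega)
  | mul a v => exact absurd (v 0).2 (by omega)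

theorem IsIHLLine.card_occurringDegrees_le {s d : ℕ} {x : ℕ → Poly}
    (h : ∀ u < s, ∃ e, (x u).IsHomogeneous e) : (occurringDegrees s d x).card ≤ s := by
  classical
  choose! e he using h
  refine (Finset.card_le_card (t := (Finset.range s).image e) fun i hi => ?_).trans
    (Finset.card_image_le.trans (by simp))
  obtain ⟨u, hu, hne⟩ := (Finset.mem_filter.1 hi).2
  refine Finset.mem_image.2 ⟨u, by simpa using hu, ?_⟩
  by_contra hei
  exact hne (homogeneousComponent_ne (he u hu) (Ne.symm hei))

theorem card_occurringDegrees_le_succ (s d : ℕ) (x : ℕ → Poly) :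
    (occurringDegrees s d x).card ≤ d + 1 :=
  (Finset.card_filter_le _ _).trans (by simp)

/-- The outputs that matter are f or its derivatives, none of which exceeds the degree of f. -/
theorem IHLCircuit.exists_computes_of_ihlComputable {s : ℕ} {c : IHLCircuit s} {f : Poly}
    (hc : c.Computes f) {n h : ℕ}
    (hS : IHLComputable n h {g | g ∈ Set.range c.val ∧ g.totalDegree ≤ f.totalDegree}) :
    ∃ (t : ℕ) (c' : IHLCircuit t), c'.Computes f ∧ t ≤ n ∧ c'.depth ≤ h := by
  obtain ⟨t, ht, c', h1, h2⟩ := hS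
  refine ⟨t, c', ?_, ht, h1⟩
  rcases hc with ⟨⟨e, he, hf⟩, hc⟩ | ⟨hf, hc⟩
  · refine .inl ⟨⟨e, he, hf⟩, fun i hi => h2 ⟨hc i hi, ?_⟩⟩
    have h0 : f ≠ 0 := by
      rintro rfl
      simp at hi
    rw [hf.totalDegree h0]
    exact hf.pderiv.totalDegree_le.trans (Nat.sub_le _ _)
  · exact .inr ⟨hf, h2 ⟨hc, le_rfl⟩⟩

theorem exists_depth_reduction (p : Polynomial ℕ) : ∃ (q : Polynomial ℕ) (K : ℝ),
    ∀ (s d : ℕ) (f : Poly) (c : IHLCircuit s),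
      c.Computes f → f.totalDegree = d → (c.IsHomogeneous ∨ d ≤ p.eval s) →
      ∃ (t : ℕ) (c' : IHLCircuit t), c'.Computes f ∧ t ≤ q.eval s ∧
        (c'.depth : ℝ) ≤ K * (Real.logb 2 s * Real.logb 2 d) := by
  set P : Polynomial ℕ := .X * (.X + p + 1) with hP
  obtain ⟨k, hk⟩ := exists_eval_le_pow P
  -- `P` bounds the size of the grammar. There are at most 2s doublings and 2 ^ (l + 1) ≤ 4 P ^ 4,
  -- whence 24 = 2 · 3 · 4; the final `X` covers the degenerate cases. The depth is at most (3 ·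
  -- clog d' + 1)(l + 1) with clog d' ≤ 2 log d and l + 1 ≤ (4k + 2) log s, whence 7 = 3 · 2 + 1.
  refine ⟨2 * P ^ 3 + 24 * Polynomial.X * P ^ 7 + 4 * Polynomial.X * P ^ 4 + Polynomial.X, 7 * (4 * k + 2),
    fun s d f c hc hd hcond => ?_⟩
  have hq : (2 * P ^ 3 + 24 * Polynomial.X * P ^ 7 + 4 * Polynomial.X * P ^ 4 + Polynomial.X).eval s =
      2 * P.eval s ^ 3 + 24 * s * P.eval s ^ 7 + 4 * s * P.eval s ^ 4 + s := by
    simp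
  rw [hq]
  have hPs : P.eval s = s * (s + p.eval s + 1) := by simp [hP]
  have hls := logb_natCast_nonneg s
  have hld := logb_natCast_nonneg d
  by_cases hs : s ≤ 1
  · refine ⟨s, c, hc, by omega, ?_⟩
    rw [c.depth_of_le_one hs]
    push_cast
    positivity
  by_cases hd2 : d ≤ 2
  · obtain ⟨t, c', h1, h2, h3⟩ := IHLCircuit.exists_computes_of_ihlComputable hc
      (c.ihlComputable_of_le_two (d := f.totalDegree) (by omega))
    refine ⟨t, c', h1, by omega, ?_⟩
    rw [Nat.le_zero.1 h3]
    push_cast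
    positivity
  -- No gate has degree above 3 ^ s, so truncation loses nothing and keeps the number of doublings
  -- linear in s.
  set d' := min d (3 ^ s) with hd'
  set D := occurringDegrees s d' (c.seq IHLGate.eval) with hD
  have hD1 : D.card ≤ s + p.eval s + 1 := by
    -- Homogeneous gates contribute one degree each, at most s in all; otherwise there are at most d
    -- + 1 ≤ p(s) + 1 degrees.
    rcases hcond with h | h
    · have : D.card ≤ s := IsIHLLine.card_occurringDegrees_le (s := s) (d := d') (x := c.seq IHLGate.eval)
        fun u hu => by
          have := h ⟨u, hu⟩
          rwa [IHLCircuit.val, ← Circuit.seq_eq] at this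
      omega
    · have : D.card ≤ d' + 1 := card_occurringDegrees_le_succ s d' (c.seq IHLGate.eval)
      omega
  have hN : s * D.card ≤ P.eval s := by
    rw [hPs]
    exact Nat.mul_le_mul_left _ hD1
  have hD2 : D.card ≤ P.eval s := (Nat.le_mul_of_pos_left _ (by omega)).trans hN
  have hP1 : 1 ≤ P.eval s := by
    rw [hPs]
    exact Nat.mul_pos (by omega) (by omega)
  set l := Nat.clog 2 (P.eval s ^ 4) with hl
  have hl1 : P.eval s ^ 4 ≤ 2 ^ l := Nat.le_pow_clog (by norm_num) _
  have hl2 : 2 ^ (l + 1) ≤ 4 * P.eval s ^ 4 := by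
    have := two_pow_clog_le (Nat.one_le_pow 4 _ hP1)
    rw [← hl] at this
    rw [pow_succ]
    omega
  have hmain := c.ihlComputable (d := d') (l := l) (k := Nat.clog 2 d')
    ((Nat.pow_le_pow_left hN 4).trans hl1)
    (hD2.trans ((Nat.le_self_pow (by norm_num) _).trans hl1)) (Nat.le_pow_clog (by norm_num) _)
  have hsub : {g | g ∈ Set.range c.val ∧ g.totalDegree ≤ f.totalDegree} ⊆
      {g | g ∈ Set.range c.val ∧ g.totalDegree ≤ d'} := by
    rintro g ⟨⟨u, rfl⟩, hg⟩
    refine ⟨⟨u, rfl⟩, le_min (by omega) ?_⟩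
    have := c.isIHLLine.totalDegree_le u u.2
    rw [Circuit.seq_eq] at this
    exact this.trans (Nat.pow_le_pow_right (by norm_num) u.2.le)
  obtain ⟨t, c', h1, h2, h3⟩ := IHLCircuit.exists_computes_of_ihlComputable hc
    (hmain.mono le_rfl le_rfl hsub)
  refine ⟨t, c', h1, h2.trans ?_, ?_⟩
  · have hk2 : Nat.clog 2 d' ≤ 2 * s := by
      rw [Nat.clog_le_iff_le_pow (by norm_num), pow_mul]
      exact (min_le_right _ _).trans (Nat.pow_le_pow_left (by norm_num) s)
    have e1 : (s * D.card) ^ 3 ≤ P.eval s ^ 3 := Nat.pow_le_pow_left hN 3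
    calc _ ≤ 2 * P.eval s ^ 3 + 2 * s * (3 * P.eval s ^ 3 * (4 * P.eval s ^ 4)) +
        s * (4 * P.eval s ^ 4) := by gcongr
      _ ≤ _ := by
        ring_nf
        omega
  · have e1 : (Nat.clog 2 d' : ℝ) ≤ 2 * Real.logb 2 d := by
      have h1 := clog_le_logb_add_one (n := d) (by omega)
      have h2 := one_le_logb (n := d) (by omega)
      have h3 : (Nat.clog 2 d' : ℝ) ≤ Nat.clog 2 d := by
        exact_mod_cast Nat.clog_mono_right 2 (min_le_left _ _)
      linarith
    have e2 : (l : ℝ) ≤ 4 * k * Real.logb 2 s + 1 := by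
      have h1 := clog_le_logb_add_one (n := P.eval s ^ 4) (Nat.one_le_pow 4 _ hP1)
      have h2 : Real.logb 2 ((P.eval s ^ 4 : ℕ) : ℝ) ≤ Real.logb 2 ((s : ℝ) ^ (4 * k)) := by
        refine Real.logb_le_logb_of_le (by norm_num) ?_ ?_
        · exact_mod_cast Nat.one_le_pow 4 _ hP1
        · have := Nat.pow_le_pow_left (hk s (by omega)) 4
          rw [← pow_mul, mul_comm k 4] at this
          exact_mod_cast this
      rw [Real.logb_pow] at h2
      rw [← hl] at h1
      push_cast at h1 h2
      linarith
    have e3 := one_le_logb (n := s) (by omega)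
    have e4 := one_le_logb (n := d) (by omega)
    have e5 : (c'.depth : ℝ) ≤ (3 * Nat.clog 2 d' + 1) * (l + 1) := by
      have : c'.depth ≤ (3 * Nat.clog 2 d' + 1) * (l + 1) := h3.trans (by ring_nf; omega)
      exact_mod_cast this
    calc (c'.depth : ℝ) ≤ (3 * Nat.clog 2 d' + 1) * (l + 1) := e5
      _ ≤ (7 * Real.logb 2 d) * ((4 * k + 2) * Real.logb 2 s) := by
        gcongr
        · linarith
        · linarith
      _ = _ := by ring

end AlgComplexity

namespace AlgComplexity

/-! ### Products of linear matrices and homogeneous branching programs -/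

section LinearMatrices

variable {n m : Type}

/-- Matrices whose entries are homogeneous linear forms. -/
def linMat (n : Type) : Set (Matrix n n Poly) := {A | ∀ i j, (A i j).IsHomogeneous 1}

variable [Fintype n]

theorem map_C_mul_mem_linMat (E : Matrix n n ℂ) {A : Matrix n n Poly} (hA : A ∈ linMat n) :
    E.map C * A ∈ linMat n := by
  intro i j
  rw [Matrix.mul_apply]
  exact IsHomogeneous.sum _ _ _ fun k _ => (hA k j).C_mul _

theorem mul_map_C_mem_linMat (E : Matrix n n ℂ) {A : Matrix n n Poly} (hA : A ∈ linMat n) :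
    A * E.map C ∈ linMat n := by
  intro i j
  rw [Matrix.mul_apply]
  refine IsHomogeneous.sum _ _ _ fun k _ => ?_
  rw [mul_comm]
  exact (hA i k).C_mul _

variable [DecidableEq n]

/-- The first linear factor absorbs the constant matrix, so at least one factor is needed. -/
theorem map_C_mul_mem_pow (E : Matrix n n ℂ) {k : ℕ} {P : Matrix n n Poly}
    (hP : P ∈ linMat n ^ (k + 1)) : E.map C * P ∈ linMat n ^ (k + 1) := by
  rw [pow_succ'] at hP ⊢
  obtain ⟨A, hA, Q, hQ, rfl⟩ := Set.mem_mul.1 hP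
  rw [← mul_assoc]
  exact Set.mul_mem_mul (map_C_mul_mem_linMat E hA) hQ

theorem mul_map_C_mem_pow (E : Matrix n n ℂ) {k : ℕ} {P : Matrix n n Poly}
    (hP : P ∈ linMat n ^ (k + 1)) : P * E.map C ∈ linMat n ^ (k + 1) := by
  rw [pow_succ] at hP ⊢
  obtain ⟨Q, hQ, A, hA, rfl⟩ := Set.mem_mul.1 hP
  rw [mul_assoc]
  exact Set.mul_mem_mul hQ (mul_map_C_mem_linMat E hA)

theorem isHomogeneous_of_mem_pow {k : ℕ} {P : Matrix n n Poly} (hP : P ∈ linMat n ^ k) (i j : n) :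
    (P i j).IsHomogeneous k := by
  induction k generalizing P i j with
  | zero =>
    rw [pow_zero, Set.mem_one] at hP
    rw [hP, Matrix.one_apply]
    split_ifs
    · exact isHomogeneous_one _ _
    · exact isHomogeneous_zero _ _ _
  | succ k ih =>
    rw [pow_succ] at hP
    obtain ⟨Q, hQ, A, hA, rfl⟩ := Set.mem_mul.1 hP
    rw [Matrix.mul_apply]
    exact IsHomogeneous.sum _ _ _ fun l _ => (ih hQ i l).mul (hA l j)

theorem fromBlocks_mem_pow [Fintype m] [DecidableEq m] {p : Type} [Fintype p] [DecidableEq p]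
    (e : p ≃ n ⊕ m) {k : ℕ} {P : Matrix n n Poly}
    {Q : Matrix m m Poly} (hP : P ∈ linMat n ^ k) (hQ : Q ∈ linMat m ^ k) :
    (Matrix.fromBlocks P 0 0 Q).submatrix e e ∈ linMat p ^ k := by
  induction k generalizing P Q with
  | zero =>
    rw [pow_zero, Set.mem_one] at *
    rw [hP, hQ, Matrix.fromBlocks_one, Matrix.submatrix_one_equiv]
  | succ k ih =>
    rw [pow_succ] at *
    obtain ⟨P', hP', A, hA, rfl⟩ := Set.mem_mul.1 hP
    obtain ⟨Q', hQ', B, hB, rfl⟩ := Set.mem_mul.1 hQ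
    have e1 : Matrix.fromBlocks (P' * A) 0 0 (Q' * B) =
        Matrix.fromBlocks P' 0 0 Q' * Matrix.fromBlocks A 0 0 B := by
      simp [Matrix.fromBlocks_multiply]
    rw [e1, ← Matrix.submatrix_mul_equiv _ _ e e e]
    refine Set.mul_mem_mul (ih hP' hQ') fun i j => ?_
    rw [Matrix.submatrix_apply]
    rcases e i with i | i <;> rcases e j with j | j
    · exact hA i j
    · exact isHomogeneous_zero _ _ _
    · exact isHomogeneous_zero _ _ _
    · exact hB i j

end LinearMatrices

/-- `f` is computed by a homogeneous branching program with `k` layers of width `w`, between two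
constant vectors. -/
def HomogeneousABP (w k : ℕ) (f : Poly) : Prop :=
  ∃ P ∈ linMat (Fin w) ^ k, ∃ a b : Fin w → ℂ, f = ∑ i, ∑ j, C (a i) * P i j * C (b j)

namespace HomogeneousABP

variable {w w' k l : ℕ} {f g : Poly}

theorem smul (hf : HomogeneousABP w k f) (c : ℂ) : HomogeneousABP w k (C c * f) := by
  obtain ⟨P, hP, a, b, rfl⟩ := hf
  refine ⟨P, hP, fun i => c * a i, b, ?_⟩
  simp_rw [Finset.mul_sum, C_mul, mul_assoc]

theorem zero (w k : ℕ) : HomogeneousABP w k 0 := by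
  refine ⟨0 ^ k, Set.pow_mem_pow fun i j => isHomogeneous_zero _ _ _, 0, 0, by simp⟩

theorem const (c : ℂ) : HomogeneousABP 1 0 (C c) :=
  ⟨1, by simp, fun _ => c, fun _ => 1, by simp⟩

theorem linear (hf : f.IsHomogeneous 1) : HomogeneousABP 1 1 f :=
  ⟨fun _ _ => f, by rw [pow_one]; exact fun _ _ => hf, fun _ => 1, fun _ => 1, by simp⟩

theorem add (hf : HomogeneousABP w k f) (hg : HomogeneousABP w' k g) :
    HomogeneousABP (w + w') k (f + g) := by
  obtain ⟨P, hP, a, b, rfl⟩ := hf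
  obtain ⟨Q, hQ, a', b', rfl⟩ := hg
  refine ⟨_, fromBlocks_mem_pow finSumFinEquiv.symm hP hQ, Sum.elim a a' ∘ finSumFinEquiv.symm,
    Sum.elim b b' ∘ finSumFinEquiv.symm, ?_⟩
  simp only [Function.comp_apply, Matrix.submatrix_apply]
  rw [Equiv.sum_comp finSumFinEquiv.symm fun i => ∑ j, C (Sum.elim a a' i) *
    Matrix.fromBlocks P 0 0 Q i (finSumFinEquiv.symm j) *
      C (Sum.elim b b' (finSumFinEquiv.symm j))]
  simp_rw [fun i => Equiv.sum_comp finSumFinEquiv.symm fun j => C (Sum.elim a a' i) *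
    Matrix.fromBlocks P 0 0 Q i j * C (Sum.elim b b' j)]
  simp [Fintype.sum_sum_type]

theorem mono (hf : HomogeneousABP w k f) (h : w ≤ w') : HomogeneousABP w' k f := by
  have := hf.add (zero (w' - w) k)
  rwa [add_zero, Nat.add_sub_cancel' h] at this

theorem sum {κ : Type} (I : Finset κ) {t : κ → Poly} (h : ∀ i ∈ I, HomogeneousABP w k (t i)) :
    HomogeneousABP (I.card * w) k (∑ i ∈ I, t i) := by
  classical
  induction I using Finset.induction_on with
  | empty => simpa using zero 0 k
  | insert i I hi ih =>
    rw [Finset.sum_insert hi, Finset.card_insert_of_notMem hi, add_mul, one_mul,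
      add_comm (I.card * w)]
    exact (h i (Finset.mem_insert_self _ _)).add
      (ih fun j hj => h j (Finset.mem_insert_of_mem hj))

theorem isHomogeneous (hf : HomogeneousABP w k f) : f.IsHomogeneous k := by
  obtain ⟨P, hP, a, b, rfl⟩ := hf
  refine IsHomogeneous.sum _ _ _ fun i _ => IsHomogeneous.sum _ _ _ fun j _ => ?_
  rw [mul_comm]
  exact ((isHomogeneous_of_mem_pow hP i j).C_mul _).C_mul _

/-- Serial composition: the rank-one matrix b a'ᵀ glues the programs and is absorbed by the last
factor of the first one. If that has no layers, f is a constant. The width does not grow. -/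
theorem mul (hf : HomogeneousABP w k f) (hg : HomogeneousABP w l g) :
    HomogeneousABP w (k + l) (f * g) := by
  rcases k with _ | k
  · obtain ⟨c, rfl⟩ := eq_C_of_isHomogeneous_zero hf.isHomogeneous
    rw [zero_add]
    exact hg.smul c
  · obtain ⟨P, hP, a, b, rfl⟩ := hf
    obtain ⟨Q, hQ, a', b', rfl⟩ := hg
    refine ⟨P * (Matrix.vecMulVec b a').map C * Q, ?_, a, b', ?_⟩
    · rw [pow_add]
      exact Set.mul_mem_mul (mul_map_C_mem_pow _ hP) hQ
    · have h1 : ∀ i j, (P * (Matrix.vecMulVec b a').map C * Q : Matrix _ _ Poly) i j =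
          (∑ m, P i m * C (b m)) * ∑ l, C (a' l) * Q l j := by
        intro i j
        simp only [Matrix.mul_apply, Matrix.map_apply, Matrix.vecMulVec_apply, C_mul]
        rw [Finset.mul_sum]
        refine Finset.sum_congr rfl fun l _ => ?_
        rw [Finset.sum_mul, Finset.sum_mul]
        exact Finset.sum_congr rfl fun m _ => by ring
      have h2 : ∑ i, ∑ j, C (a' i) * Q i j * C (b' j) =
          ∑ j, (∑ l, C (a' l) * Q l j) * C (b' j) := by
        rw [Finset.sum_comm]
        exact Finset.sum_congr rfl fun j _ => (Finset.sum_mul _ _ _).symm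
      rw [h2, Finset.sum_mul]
      refine Finset.sum_congr rfl fun i _ => ?_
      rw [Finset.mul_sum]
      refine Finset.sum_congr rfl fun j _ => ?_
      have e : ∑ j, C (a i) * P i j * C (b j) = C (a i) * ∑ m, P i m * C (b m) := by
        rw [Finset.mul_sum]
        exact Finset.sum_congr rfl fun m _ => by ring
      rw [h1, e]
      ring

/-- The boundary vectors, repeated as rows and columns of constant matrices, are absorbed into the
outer factors. -/
theorem hasABP (hf : HomogeneousABP w k f) (hk : k ≠ 0) (hfk : f.totalDegree = k) :
    HasABP w f := by
  have hw : 0 < w := by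
    by_contra h0
    obtain rfl : w = 0 := by omega
    obtain ⟨P, hP, a, b, rfl⟩ := hf
    simp at hfk
    exact hk hfk.symm
  obtain ⟨P, hP, a, b, rfl⟩ := hf
  obtain ⟨k, rfl⟩ := Nat.exists_eq_succ_of_ne_zero hk
  have h1 := mul_map_C_mem_pow (Matrix.of fun i _ => b i) (map_C_mul_mem_pow (Matrix.of fun _ j => a j) hP)
  rw [show k + 1 = max (∑ i, ∑ j, C (a i) * P i j * C (b j)).totalDegree 1 by omega,
    Set.mem_pow] at h1
  obtain ⟨A, hA⟩ := h1
  refine ⟨fun i => A i, ⟨0, hw⟩, ⟨0, hw⟩, fun i j j' => ((A i).2 j j').totalDegree_le, ?_⟩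
  rw [hA]
  simp only [Matrix.mul_apply, Matrix.map_apply, Matrix.of_apply, Finset.sum_mul]
  exact Finset.sum_comm

end HomogeneousABP

/-! ### From circuits to branching programs -/

namespace Grammar

variable {ι : Type} [Fintype ι] (G : Grammar ι)

/-- The crossing at half the degree again, but quotients of even degree may now stand alone.
Products are free in width, so only the number of summands multiplies it. -/
theorem homogeneousABP_val_step {B k : ℕ} (hV : ∀ u, G.deg u ≤ 2 ^ k →
      HomogeneousABP B (G.deg u) (G.val u))
    (hQ : ∀ u v, G.deg v ≤ G.deg u → G.deg u - G.deg v < 2 ^ k →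
      HomogeneousABP B (G.deg u - G.deg v) (G.quot u v)) (u : ι) (h2 : 2 ≤ G.deg u)
    (hu : G.deg u ≤ 2 ^ (k + 1)) :
    HomogeneousABP (Fintype.card ι ^ 4 * B) (G.deg u) (G.val u) := by
  rw [pow_succ] at hu
  rw [G.val_eq_crossing (m := G.deg u / 2) (by omega) u (by omega)]
  have h4 : (Finset.univ : Finset (ι × ι × ι × ι)).card = Fintype.card ι ^ 4 := by
    simp [Finset.card_univ, pow_succ, mul_assoc]
  rw [← h4]
  refine .sum _ ?_
  rintro ⟨t, w, a, b⟩ -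
  dsimp only
  by_cases h0 : G.crossing (G.deg u / 2) (t, w, a, b) = 0
  · rw [h0, C_0, zero_mul]
    exact .zero _ _
  obtain ⟨h1, h2, h3, h4, h5⟩ := G.crossing_ne_zero h0
  by_cases ht : G.deg u < G.deg t
  · rw [G.quot_eq_zero _ _ ht, zero_mul, zero_mul, mul_zero]
    exact .zero _ _
  have h6 := ((hQ u t (by omega) (by omega)).mul (hV a (by omega))).mul
    ((hV w (by omega)).mul (hV b (by omega)))
  rw [show G.deg u - G.deg t + G.deg a + (G.deg w + G.deg b) = G.deg u by omega] at h6
  exact h6.smul _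

theorem homogeneousABP_quot_step {B k : ℕ} (hV : ∀ u, G.deg u ≤ 2 ^ (k + 1) →
      HomogeneousABP B (G.deg u) (G.val u))
    (hQ : ∀ u v, G.deg v ≤ G.deg u → G.deg u - G.deg v < 2 ^ k →
      HomogeneousABP B (G.deg u - G.deg v) (G.quot u v)) (u v : ι) (hvu : G.deg v < G.deg u)
    (hu : G.deg u - G.deg v < 2 ^ (k + 1)) :
    HomogeneousABP (Fintype.card ι ^ 4 * B) (G.deg u - G.deg v) (G.quot u v) := by
  rw [pow_succ] at hu hV
  rw [G.quot_eq_crossing (m := G.deg v + (G.deg u - G.deg v) / 2) u v (by omega) (by omega)]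
  have h4 : (Finset.univ : Finset (ι × ι × ι × ι)).card = Fintype.card ι ^ 4 := by
    simp [Finset.card_univ, pow_succ, mul_assoc]
  rw [← h4]
  refine .sum _ ?_
  rintro ⟨t, w, a, b⟩ -
  dsimp only
  by_cases h0 : G.crossing (G.deg v + (G.deg u - G.deg v) / 2) (t, w, a, b) = 0
  · rw [h0, C_0, zero_mul]
    exact .zero _ _
  obtain ⟨h1, h2, h3, h4, h5⟩ := G.crossing_ne_zero h0
  by_cases ht : G.deg u < G.deg t
  · rw [G.quot_eq_zero _ _ ht, zero_mul, zero_mul, mul_zero]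
    exact .zero _ _
  by_cases hw : G.deg w < G.deg v
  · rw [G.quot_eq_zero _ _ hw, zero_mul, mul_zero, mul_zero]
    exact .zero _ _
  have h6 := ((hQ u t (by omega) (by omega)).mul (hV a (by omega))).mul
    ((hQ w v (by omega) (by omega)).mul (hV b (by omega)))
  rw [show G.deg u - G.deg t + G.deg a + (G.deg w - G.deg v + G.deg b) =
    G.deg u - G.deg v by omega] at h6
  exact h6.smul _

/-- Narrow branching programs for the values of a grammar. -/
theorem homogeneousABP [Nonempty ι] (k : ℕ) :
    (∀ u, G.deg u ≤ 2 ^ k →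
      HomogeneousABP ((Fintype.card ι ^ 4) ^ (2 * k)) (G.deg u) (G.val u)) ∧
    ∀ u v, G.deg v ≤ G.deg u → G.deg u - G.deg v < 2 ^ k →
      HomogeneousABP ((Fintype.card ι ^ 4) ^ (2 * k + 1)) (G.deg u - G.deg v) (G.quot u v) := by
  have hB : 0 < Fintype.card ι ^ 4 := pow_pos Fintype.card_pos 4
  set B := Fintype.card ι ^ 4 with hBdef
  have hpow : ∀ {i j : ℕ}, i ≤ j → B ^ i ≤ B ^ j := fun h => Nat.pow_le_pow_right hB h
  have hsmall : ∀ u, G.deg u ≤ 1 → ∀ W, 1 ≤ W → HomogeneousABP W (G.deg u) (G.val u) := by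
    intro u hu W hW
    have h := G.homogeneous u
    rcases Nat.le_one_iff_eq_zero_or_eq_one.1 hu with h0 | h0 <;> rw [h0] at h ⊢
    · obtain ⟨a, ha⟩ := eq_C_of_isHomogeneous_zero h
      rw [ha]
      exact (HomogeneousABP.const a).mono hW
    · exact (HomogeneousABP.linear h).mono hW
  have hquot : ∀ u v, G.deg u = G.deg v → ∀ W, 1 ≤ W →
      HomogeneousABP W (G.deg u - G.deg v) (G.quot u v) := by
    intro u v h W hW
    have h1 := G.quot_homogeneous v u
    rw [h, Nat.sub_self] at h1 ⊢
    obtain ⟨a, ha⟩ := eq_C_of_isHomogeneous_zero h1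
    rw [ha]
    exact (HomogeneousABP.const a).mono hW
  induction k with
  | zero =>
    exact ⟨fun u hu => hsmall u hu _ (Nat.one_le_pow _ _ hB),
      fun u v h1 h2 => hquot u v (by omega) _ (Nat.one_le_pow _ _ hB)⟩
  | succ k ih =>
    have hV : ∀ u, G.deg u ≤ 2 ^ (k + 1) →
        HomogeneousABP (B ^ (2 * (k + 1))) (G.deg u) (G.val u) := by
      intro u hu
      rcases Nat.lt_or_ge (G.deg u) 2 with h | h
      · exact hsmall u (by omega) _ (Nat.one_le_pow _ _ hB)
      · have := G.homogeneousABP_val_step (fun u hu => (ih.1 u hu).mono (hpow (Nat.le_succ _)))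
          ih.2 u h hu
        rw [← hBdef] at this
        rwa [show 2 * (k + 1) = 2 * k + 1 + 1 by ring, pow_succ' B (2 * k + 1)]
    refine ⟨hV, fun u v h1 h2 => ?_⟩
    rcases h1.lt_or_eq with h | h
    · have := G.homogeneousABP_quot_step hV
        (fun u v hv hu => (ih.2 u v hv hu).mono (hpow (by omega))) u v h h2
      rw [← hBdef] at this
      rwa [pow_succ' B (2 * (k + 1))]
    · exact hquot u v h.symm _ (Nat.one_le_pow _ _ hB)

end Grammar

/-- The values computed by an ordinary circuit, preceded by the constant `1`. -/
noncomputable def gateSeq {t : ℕ} (c : Circuit Gate t) : ℕ → Poly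
  | 0 => 1
  | n + 1 => c.seq Gate.eval n

theorem isStraightLine_gateSeq {t : ℕ} (c : Circuit Gate t) :
    IsStraightLine (t + 1) (gateSeq c) := by
  intro u hu
  rcases u with _ | u
  · exact .inl (by simp [gateSeq])
  obtain ⟨g, hg⟩ := c.exists_gate_seq Gate.eval (u := u) (by omega)
  rw [show gateSeq c (u + 1) = _ from hg]
  cases g with
  | var i => exact .inl (by simp [Gate.eval])
  | const a => exact .inl (by simp [Gate.eval])
  | add v w =>
    refine .inr (.inl ⟨1, 1, v + 1, w + 1, by omega, by omega, ?_⟩)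
    simp [Gate.eval, gateSeq]
  | mul v w =>
    -- The prepended constant 1 is the third factor of a binary product.
    refine .inr (.inr ⟨1, v + 1, w + 1, 0, by omega, by omega, by omega, ?_⟩)
    simp [Gate.eval, gateSeq]

/-- Here f is the degree d component of its own gate, a value of the grammar. The 8 is 4 · 2: index
quadruples, and two factors per doubling. -/
theorem exists_hasABP_of_circuit {t d : ℕ} {f : Poly} (c : Circuit Gate t)
    (hc : f ∈ Set.range (c.fold Gate.eval)) (hf : f.IsHomogeneous d) :
    ∃ w, w ≤ ((t + 1) * (f.totalDegree + 1)) ^ (8 * Nat.clog 2 f.totalDegree) ∧ HasABP w f := by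
  by_cases h0 : f.totalDegree = 0
  · refine ⟨1, Nat.one_le_pow _ _ (by positivity), ?_⟩
    refine ⟨fun _ => Matrix.of fun _ _ => f, 0, 0, fun _ _ _ => by simp [h0], ?_⟩
    rw [List.ofFn_const, List.prod_replicate, h0]
    simp
  · obtain ⟨u, rfl⟩ := hc
    have hne : c.fold Gate.eval u ≠ 0 := by
      intro h
      rw [h, totalDegree_zero] at h0
      exact h0 rfl
    have hd := hf.totalDegree hne
    rw [hd] at h0 ⊢
    obtain ⟨G, hG1, hG2⟩ := (isStraightLine_gateSeq c).exists_grammar (d := d)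
      (D := Finset.range (d + 1)) (fun i hi => by simpa [Nat.lt_succ_iff] using hi)
      (fun v _ i hi hi' => absurd (by simpa [Nat.lt_succ_iff] using hi) hi')
    have hcard : Fintype.card (Fin (t + 1) × Finset.range (d + 1)) = (t + 1) * (d + 1) := by simp
    set p : Fin (t + 1) × Finset.range (d + 1) :=
      (u.succ, ⟨d, by simp⟩) with hp
    have : Nonempty (Fin (t + 1) × Finset.range (d + 1)) := ⟨p⟩
    have h1 := (G.homogeneousABP (Nat.clog 2 d)).1 p (by
      rw [hG1]
      exact Nat.le_pow_clog (by norm_num) _)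
    have h2 : gateSeq c u.succ = c.fold Gate.eval u := by
      rw [Fin.val_succ, gateSeq, Circuit.seq_eq]
    rw [hG1, hG2, hp, hcard] at h1
    dsimp only at h1
    rw [h2, homogeneousComponent_self hf] at h1
    refine ⟨_, ?_, h1.hasABP h0 hd⟩
    rw [← pow_mul]
    exact Nat.pow_le_pow_right (by positivity) (by omega)

theorem VQP_inter_H_subset : VQP ∩ H ⊆ VQBP ∩ H := by
  refine quasiPolyClass_inter_H_subset 16 ?_ ?_
  · rintro s f d hf ⟨t, hts, c, hc⟩
    obtain ⟨w, hw, hABP⟩ := exists_hasABP_of_circuit c hc hf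
    refine ⟨w, hw.trans ?_, w, le_rfl, hABP⟩
    set X := s + f.vars.card + f.totalDegree + 2 with hX
    calc _ ≤ (X ^ 2) ^ (8 * Nat.clog 2 f.totalDegree) := by
          refine Nat.pow_le_pow_left ?_ _
          rw [sq]
          exact Nat.mul_le_mul (by omega) (by omega)
      _ = X ^ (2 * (8 * Nat.clog 2 f.totalDegree)) := (pow_mul _ _ _).symm
      _ ≤ _ := Nat.pow_le_pow_right (by omega) (by omega)
  · rintro s t f hst ⟨w, hw, h⟩
    exact ⟨w, hw.trans hst, h⟩

end AlgComplexity

namespace AlgComplexity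

/-! ### Linear parts and derivatives of matrix products -/

section LinearParts

variable {n : Type} [Fintype n] [DecidableEq n]

/-- The top-degree part of a product of matrices of affine linear forms. -/
theorem exists_linMat_pow_eq_homogeneousComponent (L : List (Matrix n n Poly))
    (hL : ∀ A ∈ L, ∀ i j, (A i j).totalDegree ≤ 1) :
    ∃ Q ∈ linMat n ^ L.length, ∀ i j, (L.prod i j).totalDegree ≤ L.length ∧
      homogeneousComponent L.length (L.prod i j) = Q i j := by
  induction L with
  | nil =>
    refine ⟨1, by simp, fun i j => ?_⟩
    have h : ((1 : Matrix n n Poly) i j).IsHomogeneous 0 := by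
      rw [Matrix.one_apply]
      split_ifs
      · exact isHomogeneous_one _ _
      · exact isHomogeneous_zero _ _ _
    rw [List.prod_nil, List.length_nil]
    exact ⟨h.totalDegree_le, homogeneousComponent_self h⟩
  | cons A L ih =>
    obtain ⟨Q, hQ, h⟩ := ih fun B hB => hL B (List.mem_cons_of_mem _ hB)
    have hA := hL A List.mem_cons_self
    refine ⟨A.map (homogeneousComponent 1) * Q, ?_, fun i j => ?_⟩
    · rw [List.length_cons, pow_succ']
      exact Set.mul_mem_mul (fun i j => homogeneousComponent_isHomogeneous _ _) hQ
    rw [List.prod_cons, List.length_cons, Matrix.mul_apply, Matrix.mul_apply]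
    constructor
    · refine (totalDegree_finsetSum _ _).trans (Finset.sup_le fun l _ => ?_)
      have h1 := totalDegree_mul (A i l) (L.prod l j)
      have h2 := hA i l
      have h3 := (h l j).1
      omega
    · rw [map_sum]
      refine Finset.sum_congr rfl fun l _ => ?_
      rw [homogeneousComponent_mul, Finset.sum_eq_single (1, L.length), (h l j).2, Matrix.map_apply]
      · rintro ⟨a, b⟩ hab hne
        rw [Finset.HasAntidiagonal.mem_antidiagonal] at hab
        dsimp only at hab ⊢
        rcases Nat.lt_or_ge 1 a with ha | ha
        · rw [homogeneousComponent_eq_zero _ _ (lt_of_le_of_lt (hA i l) ha), zero_mul]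
        · have hb : L.length < b := by
            by_contra hb
            exact hne (by rw [Prod.mk.injEq]; omega)
          rw [homogeneousComponent_eq_zero _ _ (lt_of_le_of_lt (h l j).1 hb), mul_zero]
      · intro hnot
        exact absurd (Finset.HasAntidiagonal.mem_antidiagonal.2 (by dsimp only; omega)) hnot

/-- There are as many affine factors as the degree, so the top component takes the linear part of
each; by homogeneity it is all of f. -/
theorem HasABP.exists_linMat {w d : ℕ} {f : Poly} (hf : HasABP w f) (hd : f.IsHomogeneous d)
    (h0 : f.totalDegree ≠ 0) : ∃ P ∈ linMat (Fin w) ^ d, ∃ i j, f = P i j := by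
  obtain ⟨A, i, j, hA, hfA⟩ := hf
  have hne : f ≠ 0 := by
    intro h
    rw [h, totalDegree_zero] at h0
    exact h0 rfl
  have htd := hd.totalDegree hne
  obtain ⟨Q, hQ, h⟩ := exists_linMat_pow_eq_homogeneousComponent (List.ofFn A) (by
    intro B hB
    obtain ⟨k, rfl⟩ := (List.mem_ofFn' _ _).1 hB
    exact hA k)
  have hlen : (List.ofFn A).length = d := by rw [List.length_ofFn]; omega
  rw [hlen] at hQ h
  refine ⟨Q, hQ, i, j, ?_⟩
  rw [← (h i j).2, ← hfA, homogeneousComponent_self hd]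

omit [Fintype n] [DecidableEq n] in
theorem exists_map_pderiv_eq (v : ℕ) {A : Matrix n n Poly} (hA : A ∈ linMat n) :
    ∃ E : Matrix n n ℂ, A.map (pderiv v) = E.map C := by
  have h : ∀ i j, ∃ a, pderiv v (A i j) = C a := fun i j =>
    eq_C_of_isHomogeneous_zero (isHomogeneous_pderiv (hA i j) v)
  choose E hE using h
  exact ⟨E, by ext1 i j; exact hE i j⟩

omit [DecidableEq n] in
theorem map_pderiv_mul (v : ℕ) (A B : Matrix n n Poly) :
    (A * B).map (pderiv v) = A.map (pderiv v) * B + A * B.map (pderiv v) := by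
  ext1 i j
  rw [Matrix.map_apply, Matrix.add_apply, Matrix.mul_apply, Matrix.mul_apply, Matrix.mul_apply,
    map_sum, ← Finset.sum_add_distrib]
  refine Finset.sum_congr rfl fun k _ => ?_
  rw [Derivation.leibniz, smul_eq_mul, smul_eq_mul, Matrix.map_apply, Matrix.map_apply]
  ring

/-- The derivative of a product of `k + 2` linear matrices is a sum of products of `k + 1` linear
matrices. -/
theorem exists_map_pderiv_eq_sum (v k : ℕ) {P : Matrix n n Poly} (hP : P ∈ linMat n ^ (k + 2)) :
    ∃ L : List (Matrix n n Poly), L.length = k + 2 ∧ (∀ Q ∈ L, Q ∈ linMat n ^ (k + 1)) ∧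
      P.map (pderiv v) = L.sum := by
  induction k generalizing P with
  | zero =>
    rw [zero_add, pow_two] at hP
    obtain ⟨A, hA, B, hB, rfl⟩ := Set.mem_mul.1 hP
    obtain ⟨E, hE⟩ := exists_map_pderiv_eq v hA
    obtain ⟨F, hF⟩ := exists_map_pderiv_eq v hB
    refine ⟨[E.map C * B, A * F.map C], rfl, ?_, ?_⟩
    · simp only [List.mem_cons, List.not_mem_nil, or_false, zero_add, pow_one]
      rintro Q (rfl | rfl)
      · exact map_C_mul_mem_linMat E hB
      · exact mul_map_C_mem_linMat F hA
    · rw [map_pderiv_mul, hE, hF]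
      simp
  | succ k ih =>
    rw [show k + 1 + 2 = (k + 2) + 1 by ring, pow_succ] at hP
    obtain ⟨P', hP', A, hA, rfl⟩ := Set.mem_mul.1 hP
    obtain ⟨E, hE⟩ := exists_map_pderiv_eq v hA
    obtain ⟨L, h1, h2, h3⟩ := ih hP'
    refine ⟨P' * E.map C :: L.map (· * A), by simp [h1], ?_, ?_⟩
    · intro Q hQ
      rcases List.mem_cons.1 hQ with rfl | hQ
      · exact mul_map_C_mem_pow E hP'
      · obtain ⟨Q', hQ', rfl⟩ := List.mem_map.1 hQ
        rw [pow_succ]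
        exact Set.mul_mem_mul (h2 Q' hQ') hA
    · rw [map_pderiv_mul, hE, h3, List.sum_cons, List.sum_map_mul_right, List.map_id', add_comm]

end LinearParts

/-! ### From branching programs to IHL formulas -/

section Formulas

/-- `f` is computed by an IHL formula of size at most `n`. -/
def HasIHLFormula (n : ℕ) (f : Poly) : Prop := ∃ F : IHLFormula, F.size ≤ n ∧ F.val = f

theorem HasIHLFormula.mono {m n : ℕ} {f : Poly} (h : HasIHLFormula m f) (hmn : m ≤ n) :
    HasIHLFormula n f := by
  obtain ⟨F, h1, h2⟩ := h
  exact ⟨F, h1.trans hmn, h2⟩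

theorem HasIHLFormula.mul {n : ℕ} {f g h : Poly} (hf : HasIHLFormula n f) (hg : HasIHLFormula n g)
    (hh : HasIHLFormula n h) : HasIHLFormula (3 * n + 1) (f * g * h) := by
  obtain ⟨F, h1, rfl⟩ := hf
  obtain ⟨G, h2, rfl⟩ := hg
  obtain ⟨K, h3, rfl⟩ := hh
  exact ⟨.mul F G K, by simp only [IHLFormula.size]; omega, rfl⟩

theorem HasIHLFormula.add {m n : ℕ} {f g : Poly} (hf : HasIHLFormula m f)
    (hg : HasIHLFormula n g) : HasIHLFormula (m + n + 1) (f + g) := by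
  obtain ⟨F, h1, rfl⟩ := hf
  obtain ⟨G, h2, rfl⟩ := hg
  exact ⟨.add F G, by simp only [IHLFormula.size]; omega, rfl⟩

theorem HasIHLFormula.leaf {f : Poly} (hf : f.IsHomogeneous 1) : HasIHLFormula 1 f :=
  ⟨.leaf f hf, le_rfl, rfl⟩

theorem HasIHLFormula.list_sum {n : ℕ} (L : List Poly) (h : ∀ f ∈ L, HasIHLFormula n f) :
    HasIHLFormula (L.length * (n + 1) + 1) L.sum := by
  induction L with
  | nil => simpa using HasIHLFormula.leaf (isHomogeneous_zero ℕ ℂ 1)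
  | cons f L ih =>
    rw [List.sum_cons, List.length_cons]
    refine ((h f List.mem_cons_self).add
      (ih fun g hg => h g (List.mem_cons_of_mem _ hg))).mono (le_of_eq ?_)
    ring

theorem HasIHLFormula.sum {κ : Type} {n : ℕ} (I : Finset κ) {t : κ → Poly}
    (h : ∀ i ∈ I, HasIHLFormula n (t i)) : HasIHLFormula (I.card * (n + 1) + 1) (∑ i ∈ I, t i) := by
  have := HasIHLFormula.list_sum (n := n) (I.toList.map t) (by
    intro f hf
    obtain ⟨i, hi, rfl⟩ := List.mem_map.1 hf
    exact h i (Finset.mem_toList.1 hi))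
  rwa [List.length_map, Finset.length_toList, Finset.sum_map_toList] at this

/-- With m = 2h + 1 take h, h for odd h and h - 1, h + 1 for even h. In the latter case h and 2 ^ k
are both even, so h + 1 < 2 ^ k. -/
theorem exists_odd_split {k m : ℕ} (hk : 1 ≤ k) (hm : Odd m) (h3 : 3 ≤ m) (hmk : m < 2 ^ (k + 1)) :
    ∃ a b, Odd a ∧ Odd b ∧ a < 2 ^ k ∧ b < 2 ^ k ∧ m = a + b + 1 := by
  obtain ⟨k, rfl⟩ := Nat.exists_eq_add_of_le' hk
  obtain ⟨h, rfl⟩ := hm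
  rw [pow_succ, pow_succ] at hmk
  rw [pow_succ]
  rcases Nat.even_or_odd h with hh | hh
  · obtain ⟨j, rfl⟩ := hh
    exact ⟨j + j - 1, j + j + 1, ⟨j - 1, by omega⟩, ⟨j, by omega⟩, by omega, by omega, by omega⟩
  · exact ⟨h, h, hh, hh, by omega, by omega, by omega⟩

/-- Products of an odd number of linear matrices have small formulas, by splitting them into three
products of an odd number of matrices. -/
theorem hasIHLFormula_of_mem_pow {w k : ℕ} (hk : 1 ≤ k) {m : ℕ} (hm : Odd m) (hmk : m < 2 ^ k)
    {P : Matrix (Fin w) (Fin w) Poly} (hP : P ∈ linMat (Fin w) ^ m) (i j : Fin w) :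
    HasIHLFormula ((6 * w ^ 2) ^ k) (P i j) := by
  have hw : 1 ≤ w := by have := i.2; omega
  have hw2 : 1 ≤ w ^ 2 := Nat.one_le_pow _ _ hw
  have hone : ∀ {k : ℕ} {P : Matrix (Fin w) (Fin w) Poly}, P ∈ linMat (Fin w) → ∀ i j,
      HasIHLFormula ((6 * w ^ 2) ^ k) (P i j) := fun hP i j =>
    (HasIHLFormula.leaf (hP i j)).mono (Nat.one_le_pow _ _ (by omega))
  induction k, hk using Nat.le_induction generalizing m P i j with
  | base =>
    obtain rfl : m = 1 := by
      obtain ⟨h, rfl⟩ := hm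
      omega
    rw [pow_one] at hP
    exact hone hP i j
  | succ k hk ih =>
    by_cases h3 : 3 ≤ m
    swap
    · obtain rfl : m = 1 := by
        obtain ⟨h, rfl⟩ := hm
        omega
      rw [pow_one] at hP
      exact hone hP i j
    obtain ⟨a, b, ha, hb, hak, hbk, rfl⟩ := exists_odd_split hk hm h3 hmk
    rw [pow_succ, pow_add] at hP
    obtain ⟨P', hP', A, hA, rfl⟩ := Set.mem_mul.1 hP
    obtain ⟨P₁, hP₁, P₂, hP₂, rfl⟩ := Set.mem_mul.1 hP'
    have e : (P₁ * P₂ * A) i j = ∑ x : Fin w × Fin w, P₁ i x.2 * P₂ x.2 x.1 * A x.1 j := by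
      rw [Fintype.sum_prod_type, Matrix.mul_apply]
      refine Finset.sum_congr rfl fun l _ => ?_
      rw [Matrix.mul_apply, Finset.sum_mul]
    rw [e]
    refine (HasIHLFormula.sum _ fun x _ => (ih ha hak hP₁ i x.2).mul (ih hb hbk hP₂ x.2 x.1)
      (hone hA x.1 j)).mono ?_
    rw [Finset.card_univ, Fintype.card_prod, Fintype.card_fin, ← sq, pow_succ _ k]
    have h1 : 1 ≤ (6 * w ^ 2) ^ k := Nat.one_le_pow _ _ (by omega)
    generalize (6 * w ^ 2) ^ k = B at h1 ⊢
    generalize w ^ 2 = W at hw2 ⊢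
    have h2 := Nat.mul_le_mul_left W h1
    rw [mul_one] at h2
    -- Three subformulas for each of the `W` index pairs; the additive terms turn 3 into 6 = 3 + 2 +
    -- 1.
    calc W * (3 * B + 1 + 1) + 1 = 3 * (W * B) + 2 * W + 1 := by ring
      _ ≤ 6 * (W * B) := by omega
      _ = B * (6 * W) := by ring

theorem computes3_of_totalDegree_eq_zero (S : Set Poly) {f : Poly} (h : f.totalDegree = 0) :
    Computes3 S f :=
  .inl ⟨⟨0, Even.zero, isHomogeneous_zero_of_totalDegree h⟩, by
    simp [vars_eq_empty_of_totalDegree h]⟩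

/-- For odd d the matrix entry is computed directly. For even d each derivative is a sum of d
entries of products of d - 1 matrices, an odd number. -/
theorem HasABP.exists_computes {w d : ℕ} {f : Poly} (hf : HasABP w f) (hd : f.IsHomogeneous d) :
    ∃ Fs : List IHLFormula, IHLFormula.Computes Fs f ∧ (Fs.map IHLFormula.size).sum ≤
      (f.vars.card + 1) * (f.totalDegree * ((6 * w ^ 2) ^ (Nat.clog 2 f.totalDegree + 1) + 1) + 1) := by
  by_cases h0 : f.totalDegree = 0
  · exact ⟨[], computes3_of_totalDegree_eq_zero _ h0, by simp⟩
  obtain ⟨P, hP, i, j, hfP⟩ := hf.exists_linMat hd h0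
  have hne : f ≠ 0 := by
    intro h
    rw [h, totalDegree_zero] at h0
    exact h0 rfl
  have hdk : d < 2 ^ (Nat.clog 2 d + 1) := by
    have := Nat.le_pow_clog (b := 2) (by norm_num) d
    have h1 : 0 < 2 ^ Nat.clog 2 d := by positivity
    rw [pow_succ]
    omega
  rw [hd.totalDegree hne] at h0 ⊢
  set B := (6 * w ^ 2) ^ (Nat.clog 2 d + 1) with hB
  rcases Nat.even_or_odd d with he | ho
  · obtain ⟨k, rfl⟩ : ∃ k, d = k + 2 := by
      obtain ⟨r, rfl⟩ := he
      exact ⟨r + r - 2, by omega⟩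
    have hF : ∀ v, HasIHLFormula ((k + 2) * (B + 1) + 1) (pderiv v f) := by
      intro v
      obtain ⟨L, h1, h2, h3⟩ := exists_map_pderiv_eq_sum v k hP
      have e : pderiv v f = (L.map fun Q => Q i j).sum := by
        have e1 : pderiv v f = (P.map (pderiv v)) i j := by rw [Matrix.map_apply, hfP]
        rw [e1, h3]
        have e2 := map_list_sum (Matrix.entryAddMonoidHom Poly i j) L
        exact e2
      rw [e, ← h1]
      have := HasIHLFormula.list_sum (n := B) (L.map fun Q => Q i j) (by
        intro g hg
        obtain ⟨Q, hQ, rfl⟩ := List.mem_map.1 hg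
        refine hasIHLFormula_of_mem_pow (by omega) ?_ (by omega) (h2 Q hQ) i j
        rw [Nat.even_add_one, Nat.not_even_iff_odd] at he
        exact he)
      rwa [List.length_map] at this
    choose F hF1 hF2 using hF
    refine ⟨f.vars.toList.map F, .inl ⟨⟨_, he, hd⟩, fun v hv => ?_⟩, ?_⟩
    · exact ⟨F v, List.mem_map_of_mem (Finset.mem_toList.2 hv), hF2 v⟩
    · rw [List.map_map]
      have := List.sum_le_card_nsmul (f.vars.toList.map (IHLFormula.size ∘ F))
        ((k + 2) * (B + 1) + 1) (by
          intro x hx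
          obtain ⟨v, -, rfl⟩ := List.mem_map.1 hx
          exact hF1 v)
      rw [List.length_map, Finset.length_toList, smul_eq_mul] at this
      refine this.trans (Nat.mul_le_mul_right _ (by omega))
  · obtain ⟨F, hF1, hF2⟩ := hasIHLFormula_of_mem_pow (by omega) ho hdk hP i j
    refine ⟨[F], .inr ⟨?_, F, List.mem_singleton_self F, by rw [hF2, hfP]⟩, ?_⟩
    · rintro ⟨e, he, hfe⟩
      rw [hd.inj_right hfe hne] at ho
      exact Nat.not_even_iff_odd.2 ho he
    · rw [List.map_singleton, List.sum_singleton]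
      refine hF1.trans ?_
      rw [← hB]
      have : 1 ≤ d := by omega
      calc B ≤ d * (B + 1) + 1 := by nlinarith
        _ ≤ _ := Nat.le_mul_of_pos_left _ (by omega)

theorem VQBP_inter_H_subset : VQBP ∩ H ⊆ VQ3F := by
  rw [VQ3F, Set.inter_comm H]
  refine quasiPolyClass_inter_H_subset 8 ?_ ?_
  · rintro s f d hf ⟨w, hws, hw⟩
    obtain ⟨Fs, h1, h2⟩ := hw.exists_computes hf
    refine ⟨_, h2.trans ?_, Fs, le_rfl, h1⟩
    set X := s + f.vars.card + f.totalDegree + 2 with hX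
    set e := Nat.clog 2 f.totalDegree + 1 with he
    have hB : (6 * w ^ 2) ^ e ≤ X ^ (5 * e) := by
      rw [pow_mul]
      refine Nat.pow_le_pow_left ?_ _
      calc 6 * w ^ 2 ≤ X ^ 3 * X ^ 2 := Nat.mul_le_mul
            (le_trans (by norm_num) (Nat.pow_le_pow_left (show 2 ≤ X by omega) 3))
            (Nat.pow_le_pow_left (by omega) 2)
        _ = X ^ 5 := by ring
    have hB1 : 1 ≤ X ^ (5 * e) := Nat.one_le_pow _ _ (by omega)
    calc _ ≤ X * (f.totalDegree * (X ^ (5 * e) + 1) + 1) :=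
          Nat.mul_le_mul (by omega) (by gcongr)
      _ ≤ X * ((f.totalDegree + 1) * (2 * X ^ (5 * e))) := by
          gcongr
          nlinarith
      _ ≤ X * (X * (X * X ^ (5 * e))) := by
          gcongr <;> omega
      _ = X ^ (3 + 5 * e) := by ring
      _ ≤ X ^ (8 * e) := Nat.pow_le_pow_right (by omega) (by omega)
  · rintro s t f hst ⟨Fs, h1, h2⟩
    exact ⟨Fs, h1.trans hst, h2⟩

end Formulas
end AlgComplexity

namespace AlgComplexity

theorem Computes3.mono {S S' : Set Poly} {f : Poly} (h : Computes3 S f) (hS : S ⊆ S') :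
    Computes3 S' f :=
  h.imp (fun h => ⟨h.1, fun i hi => hS (h.2 i hi)⟩) fun h => ⟨h.1, hS h.2⟩

/-! ### From IHL formulas to IHL circuits -/

section FormulasToCircuits

theorem IHLComputable.insert {n h : ℕ} {S : Set Poly} (hS : IHLComputable n h S) {f : Poly}
    (hf : OneStep S f) : IHLComputable (n + 1) (h + 1) (insert f S) := by
  have := hS.step {f} (by simpa using hf)
  exact this.mono le_rfl le_rfl (by simp)

/-- The vertices are appended as gates to a circuit that retains `S`; only the size is controlled.
-/
theorem IHLComputable.formula (F : IHLFormula) {n h : ℕ} {S : Set Poly}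
    (hS : IHLComputable n h S) : ∃ h', IHLComputable (n + F.size) h' (Insert.insert F.val S) := by
  induction F generalizing n h S with
  | leaf l hl => exact ⟨_, hS.insert (.leaf l hl)⟩
  | add F G ihF ihG =>
    obtain ⟨h₁, hF⟩ := ihF hS
    obtain ⟨h₂, hG⟩ := ihG hF
    have h3 := hG.insert (.add 1 1 F.val G.val (by simp) (by simp))
    rw [C_1, one_mul, one_mul] at h3
    exact ⟨_, h3.mono (by simp only [IHLFormula.size]; omega) le_rfl
      (Set.insert_subset_insert ((Set.subset_insert _ _).trans (Set.subset_insert _ _)))⟩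
  | mul F G K ihF ihG ihK =>
    obtain ⟨h₁, hF⟩ := ihF hS
    obtain ⟨h₂, hG⟩ := ihG hF
    obtain ⟨h₃, hK⟩ := ihK hG
    have h3 := hK.insert (.mul 1 F.val G.val K.val (by simp) (by simp) (by simp))
    rw [C_1, one_mul] at h3
    exact ⟨_, h3.mono (by simp only [IHLFormula.size]; omega) le_rfl
      (Set.insert_subset_insert ((Set.subset_insert _ _).trans ((Set.subset_insert _ _).trans
        (Set.subset_insert _ _))))⟩

theorem IHLComputable.formulas (Fs : List IHLFormula) :
    ∃ h, IHLComputable (Fs.map IHLFormula.size).sum h {p | ∃ F ∈ Fs, F.val = p} := by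
  induction Fs with
  | nil => exact ⟨0, 0, le_rfl, .nil, by simp [IHLCircuit.depth], by simp⟩
  | cons F Fs ih =>
    obtain ⟨h, hFs⟩ := ih
    obtain ⟨h', hF⟩ := hFs.formula F
    refine ⟨h', hF.mono (by simp [add_comm]) le_rfl ?_⟩
    rintro p ⟨G, hG, rfl⟩
    rcases List.mem_cons.1 hG with rfl | hG
    · exact .inl rfl
    · exact .inr ⟨G, hG, rfl⟩

theorem VQ3F_subset_VQ3P : VQ3F ⊆ VQ3P := by
  rintro f ⟨hH, hf, c, hc, h⟩
  refine ⟨hH, hf, c, hc, fun n => ?_⟩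
  obtain ⟨Fs, h1, h2⟩ := h n
  obtain ⟨_, t, ht, c', -, hS⟩ := IHLComputable.formulas Fs
  exact ⟨t, ht.trans h1, c', h2.mono hS⟩

end FormulasToCircuits

/-! ### Ordinary circuits and formulas -/

section OrdinaryCircuits

/-- All elements of `S` are computed by a circuit of size at most `n`. -/
def Computable (n : ℕ) (S : Set Poly) : Prop :=
  ∃ t, t ≤ n ∧ ∃ c : Circuit Gate t, S ⊆ Set.range (c.fold Gate.eval)

theorem Computable.mono {n n' : ℕ} {S S' : Set Poly} (h : Computable n S) (hn : n ≤ n')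
    (hS : S' ⊆ S) : Computable n' S' := by
  obtain ⟨t, ht, c, hc⟩ := h
  exact ⟨t, ht.trans hn, c, hS.trans hc⟩

theorem Computable.empty : Computable 0 ∅ := ⟨0, le_rfl, .nil, by simp⟩

/-- Adding `m` gates to any circuit which computes all elements of `S` suffices to compute `f`. -/
def Derives (m : ℕ) (S : Set Poly) (f : Poly) : Prop :=
  ∀ n T, S ⊆ T → Computable n T → Computable (n + m) (insert f T)

theorem derives_of_gate {S : Set Poly} {f : Poly}
    (h : ∀ (t : ℕ) (c : Circuit Gate t), S ⊆ Set.range (c.fold Gate.eval) →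
      ∃ g : Gate t, g.eval t (c.fold Gate.eval) = f) : Derives 1 S f := by
  rintro n T hST ⟨t, ht, c, hc⟩
  obtain ⟨g, hg⟩ := h t c (hST.trans hc)
  refine ⟨t + 1, Nat.succ_le_succ ht, c.snoc g, ?_⟩
  rintro p (rfl | hp)
  · exact ⟨Fin.last t, (Circuit.fold_last _ _ _).trans hg⟩
  · obtain ⟨u, hu⟩ := hc hp
    exact ⟨u.castSucc, (Circuit.fold_castSucc _ _ _ _).trans hu⟩

namespace Derives

variable {m m' : ℕ} {S S' : Set Poly} {f g : Poly}

theorem mono (h : Derives m S f) (hm : m ≤ m') (hS : S ⊆ S') : Derives m' S' f :=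
  fun n T hT hc => (h n T (hS.trans hT) hc).mono (by omega) subset_rfl

theorem var (S : Set Poly) (i : ℕ) : Derives 1 S (X i) :=
  derives_of_gate fun _ _ _ => ⟨.var i, rfl⟩

theorem const (S : Set Poly) (a : ℂ) : Derives 1 S (C a) :=
  derives_of_gate fun _ _ _ => ⟨.const a, rfl⟩

theorem of_mem (h : f ∈ S) : Derives 0 S f := fun n T hT hc => by
  rwa [Set.insert_eq_of_mem (hT h)]

theorem comp (hf : Derives m S f) (hg : Derives m' (insert f S) g) : Derives (m + m') S g :=
  fun n T hT hc => (hg _ _ (Set.insert_subset_insert hT) (hf n T hT hc)).mono (by omega)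
    (Set.insert_subset_insert (Set.subset_insert _ _))

theorem add (hf : Derives m S f) (hg : Derives m' S g) : Derives (m + m' + 1) S (f + g) := by
  refine (hf.comp ((hg.mono le_rfl (Set.subset_insert _ _)).comp (derives_of_gate
    fun t c hc => ?_))).mono (by omega) subset_rfl
  obtain ⟨u, hu⟩ := hc (show f ∈ _ by simp)
  obtain ⟨v, hv⟩ := hc (show g ∈ _ by simp)
  exact ⟨.add u v, by rw [Gate.eval, hu, hv]⟩

theorem mul (hf : Derives m S f) (hg : Derives m' S g) : Derives (m + m' + 1) S (f * g) := by
  refine (hf.comp ((hg.mono le_rfl (Set.subset_insert _ _)).comp (derives_of_gate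
    fun t c hc => ?_))).mono (by omega) subset_rfl
  obtain ⟨u, hu⟩ := hc (show f ∈ _ by simp)
  obtain ⟨v, hv⟩ := hc (show g ∈ _ by simp)
  exact ⟨.mul u v, by rw [Gate.eval, hu, hv]⟩

theorem sum {κ : Type} (I : Finset κ) {t : κ → Poly} (h : ∀ i ∈ I, Derives m S (t i)) :
    Derives (I.card * (m + 1) + 1) S (∑ i ∈ I, t i) := by
  classical
  induction I using Finset.induction_on with
  | empty => simpa using const S 0
  | insert i I hi ih =>
    rw [Finset.sum_insert hi, Finset.card_insert_of_notMem hi]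
    refine ((h i (Finset.mem_insert_self _ _)).add
      (ih fun j hj => h j (Finset.mem_insert_of_mem hj))).mono (le_of_eq ?_) subset_rfl
    ring

theorem formula (F : Formula) (S : Set Poly) : Derives F.size S F.val := by
  induction F with
  | var i => exact var S i
  | const a => exact const S a
  | add F G ihF ihG => exact ihF.add ihG
  | mul F G ihF ihG => exact ihF.mul ihG

end Derives

theorem VQF_inter_H_subset : VQF ∩ H ⊆ VQP ∩ H := by
  rintro f ⟨⟨hf, c, hc, h⟩, hH⟩
  refine ⟨⟨hf, c, hc, fun n => ?_⟩, hH⟩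
  obtain ⟨F, h1, h2⟩ := h n
  obtain ⟨t, ht, c', hc'⟩ := Derives.formula F ∅ 0 ∅ subset_rfl .empty
  exact ⟨t, by omega, c', h2 ▸ hc' (Set.mem_insert _ _)⟩

end OrdinaryCircuits

/-! ### Simulating IHL computations by ordinary ones -/

section Restriction

/-- Setting all variables outside `V` to zero. -/
noncomputable def restrict (V : Finset ℕ) : Poly →ₐ[ℂ] Poly :=
  aeval fun i => if i ∈ V then X i else 0

theorem restrict_X {V : Finset ℕ} {i : ℕ} (hi : i ∈ V) : restrict V (X i) = X i := by
  rw [restrict, aeval_X, if_pos hi]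

theorem restrict_C (V : Finset ℕ) (a : ℂ) : restrict V (C a) = C a := by
  rw [restrict, aeval_C]
  rfl

theorem restrict_vars (f : Poly) : restrict f.vars f = f := by
  have h := hom_congr_vars (f₁ := (restrict f.vars : Poly →+* Poly)) (f₂ := RingHom.id Poly)
    (p₁ := f) (p₂ := f) (by ext a; simp) (by
      intro i hi _
      simpa using restrict_X hi) rfl
  simpa using h

/-- A linear form restricted to the variables in `V` is a short sum. -/
theorem exists_restrict_eq_sum (V : Finset ℕ) {l : Poly} (hl : l.IsHomogeneous 1) :
    ∃ (I : Finset ℕ) (a : ℕ → ℂ), I.card ≤ V.card ∧ restrict V l = ∑ i ∈ I, X i * C (a i) := by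
  classical
  have h : ∀ i, ∃ a, pderiv i l = C a := fun i =>
    eq_C_of_isHomogeneous_zero (isHomogeneous_pderiv hl i)
  choose a ha using h
  refine ⟨l.vars ∩ V, a, Finset.card_le_card Finset.inter_subset_right, ?_⟩
  have h1 := euler_identity hl
  rw [Nat.cast_one, one_mul] at h1
  conv_lhs => rw [← h1]
  rw [map_sum, ← Finset.sum_filter_add_sum_filter_not _ (· ∈ V), Finset.filter_mem_eq_inter]
  have h2 : ∑ i ∈ l.vars with i ∉ V, restrict V (X i * pderiv i l) = 0 := by
    refine Finset.sum_eq_zero fun i hi => ?_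
    rw [map_mul, restrict, aeval_X, if_neg (Finset.mem_filter.1 hi).2, zero_mul]
  rw [h2, add_zero]
  refine Finset.sum_congr rfl fun i hi => ?_
  rw [map_mul, restrict_X (Finset.mem_inter.1 hi).2, ha, restrict_C]

/-- Recovering a homogeneous polynomial of positive degree from its restricted derivatives. -/
theorem eq_sum_restrict_pderiv {f : Poly} {d : ℕ} (hf : f.IsHomogeneous d) (hd : d ≠ 0) :
    f = C (d : ℂ)⁻¹ * ∑ i ∈ f.vars, X i * restrict f.vars (pderiv i f) := by
  have h1 := congrArg (restrict f.vars) (euler_identity hf)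
  rw [map_sum, map_mul, restrict_vars, map_natCast] at h1
  have h2 : ∑ i ∈ f.vars, X i * restrict f.vars (pderiv i f) = (d : Poly) * f := by
    rw [← h1]
    refine Finset.sum_congr rfl fun i hi => ?_
    rw [map_mul, restrict_X hi]
  have h3 : (d : Poly) = C (d : ℂ) := (map_natCast C d).symm
  rw [h2, h3, ← mul_assoc, ← C_mul, inv_mul_cancel₀ (Nat.cast_ne_zero.2 hd), C_1, one_mul]

/-- A leaf may involve arbitrarily many variables, hence the restriction, after which it costs at
most 4|V| + 1 gates. A sum with its two scalars costs 5, a product 4. -/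
theorem IsIHLLine.computable_restrict {s : ℕ} {x : ℕ → Poly} (hx : IsIHLLine s x) (V : Finset ℕ)
    (u : ℕ) (hu : u ≤ s) :
    Computable (u * (4 * V.card + 5)) {p | ∃ v < u, restrict V (x v) = p} := by
  induction u with
  | zero => simpa using Computable.empty
  | succ u ih =>
    set S : Set Poly := {p | ∃ v < u, restrict V (x v) = p} with hS
    have hmem : ∀ v < u, Derives 0 S (restrict V (x v)) := fun v hv => .of_mem ⟨v, hv, rfl⟩
    have key : Derives (4 * V.card + 5) S (restrict V (x u)) := by
      rcases hx u (by omega) with h | ⟨a, b, v, w, hv, hw, h⟩ | ⟨a, v, w, z, hv, hw, hz, h⟩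
      · obtain ⟨I, a, hI, e⟩ := exists_restrict_eq_sum V h
        rw [e]
        exact (Derives.sum I fun i _ => (Derives.var S i).mul (.const S (a i))).mono
          (by omega) subset_rfl
      · rw [h, map_add, map_mul, map_mul, restrict_C, restrict_C]
        exact (((Derives.const S a).mul (hmem v hv)).add ((Derives.const S b).mul (hmem w hw))).mono
          (by omega) subset_rfl
      · rw [h, map_mul, map_mul, map_mul, restrict_C]
        exact ((Derives.const S a).mul (((hmem v hv).mul (hmem w hw)).mul (hmem z hz))).mono
          (by omega) subset_rfl
    refine (key _ _ subset_rfl (ih (by omega))).mono (by ring_nf; omega) ?_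
    rintro p ⟨v, hv, rfl⟩
    rcases (Nat.lt_succ_iff_lt_or_eq.1 hv) with hv | rfl
    · exact .inr ⟨v, hv, rfl⟩
    · exact .inl rfl

theorem IHLCircuit.exists_circuit {s d : ℕ} (c : IHLCircuit s) {f : Poly} (hc : c.Computes f)
    (hf : f.IsHomogeneous d) : ∃ t, t ≤ s * (4 * f.vars.card + 5) + (3 * f.vars.card + 3) ∧
      ∃ c' : Circuit Gate t, f ∈ Set.range (c'.fold Gate.eval) := by
  suffices h : ∃ S, Computable (s * (4 * f.vars.card + 5)) S ∧ Derives (3 * f.vars.card + 3) S f by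
    obtain ⟨S, hS, h⟩ := h
    obtain ⟨t, ht, c', h'⟩ := h _ _ subset_rfl hS
    exact ⟨t, ht, c', h' (Set.mem_insert _ _)⟩
  have h1 := c.isIHLLine.computable_restrict f.vars s le_rfl
  set S : Set Poly := {p | ∃ v < s, restrict f.vars (c.seq IHLGate.eval v) = p} with hS
  have hmem : ∀ g ∈ Set.range c.val, Derives 0 S (restrict f.vars g) := by
    rintro _ ⟨u, rfl⟩
    exact .of_mem ⟨u, u.2, by rw [Circuit.seq_eq]; rfl⟩
  refine ⟨S, h1, ?_⟩
  rcases hc with ⟨-, hc⟩ | ⟨-, hc⟩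
  · rcases Nat.eq_zero_or_pos d with rfl | hd
    · obtain ⟨a, rfl⟩ := eq_C_of_isHomogeneous_zero hf
      exact (Derives.const S a).mono (by omega) subset_rfl
    · rw [show Derives (3 * f.vars.card + 3) S f ↔ Derives (3 * f.vars.card + 3) S
        (C (d : ℂ)⁻¹ * ∑ i ∈ f.vars, X i * restrict f.vars (pderiv i f)) by
          rw [← eq_sum_restrict_pderiv hf hd.ne']]
      exact ((Derives.const S _).mul (Derives.sum f.vars fun i hi =>
        (Derives.var S i).mul (hmem _ (hc i hi)))).mono (by omega) subset_rfl
  · have := hmem f hc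
    rw [restrict_vars] at this
    exact this.mono (by omega) subset_rfl

theorem VQ3P_subset : VQ3P ⊆ VQP ∩ H := by
  rw [VQ3P, Set.inter_comm H]
  refine quasiPolyClass_inter_H_subset 5 ?_ ?_
  · rintro s f d hf ⟨t, hts, c, hc⟩
    obtain ⟨t', ht', c', h⟩ := c.exists_circuit hc hf
    refine ⟨t', ht'.trans ?_, t', le_rfl, c', h⟩
    set Y := s + f.vars.card + f.totalDegree + 2 with hY
    calc _ ≤ Y * (4 * Y) + 3 * Y := by gcongr <;> omega
      _ ≤ Y * (4 * Y) + Y * (4 * Y) := by nlinarith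
      _ = 2 ^ 3 * Y ^ 2 := by ring
      _ ≤ Y ^ 3 * Y ^ 2 := by gcongr; omega
      _ = Y ^ 5 := by ring
      _ ≤ _ := Nat.pow_le_pow_right (by omega) (by omega)
  · rintro s t f hst ⟨r, hr, h⟩
    exact ⟨r, hr.trans hst, h⟩

/-- `f` is computed by a formula of size at most `n`. -/
def HasFormula (n : ℕ) (f : Poly) : Prop := ∃ F : Formula, F.size ≤ n ∧ F.val = f

namespace HasFormula

variable {m n : ℕ} {f g : Poly}

theorem mono (h : HasFormula m f) (hmn : m ≤ n) : HasFormula n f := by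
  obtain ⟨F, h1, h2⟩ := h
  exact ⟨F, h1.trans hmn, h2⟩

theorem var (i : ℕ) : HasFormula 1 (X i) := ⟨.var i, le_rfl, rfl⟩

theorem const (a : ℂ) : HasFormula 1 (C a) := ⟨.const a, le_rfl, rfl⟩

theorem add (hf : HasFormula m f) (hg : HasFormula n g) : HasFormula (m + n + 1) (f + g) := by
  obtain ⟨F, h1, rfl⟩ := hf
  obtain ⟨G, h2, rfl⟩ := hg
  exact ⟨.add F G, by simp only [Formula.size]; omega, rfl⟩

theorem mul (hf : HasFormula m f) (hg : HasFormula n g) : HasFormula (m + n + 1) (f * g) := by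
  obtain ⟨F, h1, rfl⟩ := hf
  obtain ⟨G, h2, rfl⟩ := hg
  exact ⟨.mul F G, by simp only [Formula.size]; omega, rfl⟩

theorem sum {κ : Type} (I : Finset κ) {t : κ → Poly} (h : ∀ i ∈ I, HasFormula m (t i)) :
    HasFormula (I.card * (m + 1) + 1) (∑ i ∈ I, t i) := by
  classical
  induction I using Finset.induction_on with
  | empty => simpa using const 0
  | insert i I hi ih =>
    rw [Finset.sum_insert hi, Finset.card_insert_of_notMem hi]
    refine ((h i (Finset.mem_insert_self _ _)).add
      (ih fun j hj => h j (Finset.mem_insert_of_mem hj))).mono (le_of_eq ?_)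
    ring

end HasFormula

theorem IHLFormula.hasFormula_restrict (V : Finset ℕ) (F : IHLFormula) :
    HasFormula ((4 * V.card + 2) * F.size) (restrict V F.val) := by
  induction F with
  | leaf l hl =>
    obtain ⟨I, a, hI, e⟩ := exists_restrict_eq_sum V hl
    rw [IHLFormula.val, e]
    exact (HasFormula.sum I fun i _ => (HasFormula.var i).mul (.const (a i))).mono
      (by simp only [IHLFormula.size]; omega)
  | add F G ihF ihG =>
    rw [IHLFormula.val, map_add]
    refine (ihF.add ihG).mono ?_
    simp only [IHLFormula.size, mul_add]
    omega
  | mul F G K ihF ihG ihK =>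
    rw [IHLFormula.val, map_mul, map_mul]
    refine ((ihF.mul ihG).mul ihK).mono ?_
    simp only [IHLFormula.size, mul_add]
    omega

/-- In even positive degree Euler's identity needs one derivative formula per variable; constants
are computed directly, and in the remaining case restriction to its own variables fixes f. -/
theorem IHLFormula.Computes.hasFormula {Fs : List IHLFormula} {f : Poly} {d s : ℕ}
    (h : IHLFormula.Computes Fs f) (hf : f.IsHomogeneous d)
    (hs : (Fs.map IHLFormula.size).sum ≤ s) :
    HasFormula ((f.vars.card + 1) * ((4 * f.vars.card + 2) * s + 3) + 3) f := by
  have hmem : ∀ g, (∃ F ∈ Fs, F.val = g) →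
      HasFormula ((4 * f.vars.card + 2) * s) (restrict f.vars g) := by
    rintro _ ⟨F, hF, rfl⟩
    refine (F.hasFormula_restrict f.vars).mono (Nat.mul_le_mul_left _ (le_trans ?_ hs))
    exact List.single_le_sum (fun _ _ => Nat.zero_le _) _ (List.mem_map_of_mem hF)
  rcases h with ⟨-, h⟩ | ⟨-, h⟩
  · rcases Nat.eq_zero_or_pos d with rfl | hd
    · obtain ⟨a, rfl⟩ := eq_C_of_isHomogeneous_zero hf
      exact (HasFormula.const a).mono (by omega)
    · have h1 := (HasFormula.const (d : ℂ)⁻¹).mul (HasFormula.sum f.vars fun i hi =>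
        (HasFormula.var i).mul (hmem _ (h i hi)))
      rw [← eq_sum_restrict_pderiv hf hd.ne'] at h1
      refine h1.mono ?_
      rw [add_mul f.vars.card 1, one_mul, show 1 + (4 * f.vars.card + 2) * s + 1 + 1 =
        (4 * f.vars.card + 2) * s + 3 by ring]
      omega
  · have h1 := hmem f h
    rw [restrict_vars] at h1
    refine h1.mono ?_
    rw [add_mul f.vars.card 1, one_mul]
    omega

theorem VQ3F_subset : VQ3F ⊆ VQF ∩ H := by
  rw [VQ3F, Set.inter_comm H]
  refine quasiPolyClass_inter_H_subset 7 ?_ ?_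
  · rintro s f d hf ⟨Fs, hs, h⟩
    obtain ⟨F, hF1, hF2⟩ := h.hasFormula hf hs
    refine ⟨_, hF1.trans ?_, F, le_rfl, hF2⟩
    set Y := s + f.vars.card + f.totalDegree + 2 with hY
    have hY2 : 2 ≤ Y := by omega
    have h2 : Y ≤ Y ^ 2 := Nat.le_self_pow (by norm_num) _
    have h3 : Y ≤ Y ^ 3 := Nat.le_self_pow (by norm_num) _
    calc _ ≤ Y * (4 * Y * Y + 3) + 3 := by gcongr <;> omega
      _ = 4 * Y ^ 3 + 3 * Y + 3 := by ring
      _ ≤ 2 ^ 4 * Y ^ 3 := by omega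
      _ ≤ Y ^ 4 * Y ^ 3 := by gcongr
      _ = Y ^ 7 := by ring
      _ ≤ _ := Nat.pow_le_pow_right (by omega) (by omega)
  · rintro s t f hst ⟨F, hF, h⟩
    exact ⟨F, hF.trans hst, h⟩

end Restriction

end AlgComplexity

theorem mainTheorem7 :
    -- depth reduction over the arity 3 basis
    (∀ p : Polynomial ℕ, ∃ (q : Polynomial ℕ) (C : ℝ),
      ∀ (s d : ℕ) (f : AlgComplexity.Poly) (c : AlgComplexity.IHLCircuit s),
        c.Computes f → f.totalDegree = d → (c.IsHomogeneous ∨ d ≤ p.eval s) →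
        ∃ (t : ℕ) (c' : AlgComplexity.IHLCircuit t),
          c'.Computes f ∧ t ≤ q.eval s ∧
          (c'.depth : ℝ) ≤ C * (Real.logb 2 s * Real.logb 2 d)) ∧
    -- the classes coincide
    AlgComplexity.VQ3F = AlgComplexity.VQ3P ∧
    AlgComplexity.VQ3F = AlgComplexity.VQF ∩ AlgComplexity.H ∧
    AlgComplexity.VQF ∩ AlgComplexity.H = AlgComplexity.VQBP ∩ AlgComplexity.H ∧
    AlgComplexity.VQBP ∩ AlgComplexity.H = AlgComplexity.VQP ∩ AlgComplexity.H ∧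
    AlgComplexity.VQP ∩ AlgComplexity.H = AlgComplexity.VQ3P := by
  have h1 := AlgComplexity.VQ3F_subset_VQ3P
  have h2 := AlgComplexity.VQ3P_subset
  have h3 := AlgComplexity.VQP_inter_H_subset
  have h4 := AlgComplexity.VQBP_inter_H_subset
  have h5 := AlgComplexity.VQ3F_subset
  have h6 := AlgComplexity.VQF_inter_H_subset
  -- The inclusions form the cycle VQ3F ⊆ VQ3P ⊆ VQP_H ⊆ VQBP_H ⊆ VQ3F, with VQF_H lying between
  -- VQ3F and VQP_H.
  exact ⟨AlgComplexity.exists_depth_reduction,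
    h1.antisymm (h2.trans (h3.trans h4)),
    h5.antisymm (h6.trans (h3.trans h4)),
    (h6.trans h3).antisymm (h4.trans h5),
    (h4.trans (h5.trans h6)).antisymm h3,
    (h3.trans (h4.trans h1)).antisymm h2⟩
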